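/- Let $K$ be a field of characteristic $0$ (for instance $\mathbb{R}$ or $\mathbb{C}$), let $\ell,n,d\ge 1$, and let $R=K[x_{ij} : 1\le i\le \ell,\ 1\le j\le n]$. The symmetric group $\mathfrak{S}_n$ acts on $R$ by $\sigma\cdot x_{ij}=x_{i\sigma(j)}$. For $f\in R$ let $\mathcal{M}_f$ be the smallest $K$-subspace of $R$ that contains $\sigma\cdot f$ for all $\sigma\in\mathfrak{S}_n$ and is closed under all partial derivatives $\partial_{ij}=\partial/\partial x_{ij}$ and all operators $E_{i,k}^{(p)}=\sum_{j=1}^n x_{ij}\,\partial_{kj}^{\,p}$ ($1\le i,k\le \ell$, $p\ge 1$); it is stable under $\mathfrak{S}_n$. For $\delta\in\mathbb{N}^\ell$ let $\mathcal{M}_{f,\delta}$ be the intersection of $\mathcal{M}_f$ with the span of the monomials having degree $\delta_i$ in the variables $x_{i1},\dots,x_{in}$ for each $i$, and let $\chi_{f,\delta}$ be its $\mathfrak{S}_n$-character. The graded Frobenius characteristic of $\mathcal{M}_f$ is $$\mathcal{M}_f(\mathbf q,\mathbf w)=\sum_{\delta\in\mathbb{N}^\ell}\Big(\frac1{n!}\sum_{\sigma\in\mathfrak{S}_n}\chi_{f,\delta}(\sigma)\,p_{\lambda(\sigma)}(\mathbf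 w)\Big)\mathbf q^{\delta},$$ where $\mathbf q=(q_1,\dots,q_\ell)$, $\mathbf w=(w_1,w_2,\dots)$, $\lambda(\sigma)$ is the cycle type of $\sigma$, and $p_\lambda$ is the power sum symmetric function. Write $h_k$ for the complete homogeneous symmetric functions, $h_{a,b}=h_ah_b$, and $s_\lambda$ for the Schur functions, with the convention $s_{0,1}=0$. Let $p_k=\sum_{j} x_{1j}^k$ and let $e_d$ be the elementary symmetric polynomial of degree $d$ in the first set of variables $x_{11},\dots,x_{1n}$. Then: 1. $$\mathcal{M}_{p_1^d}(\mathbf q,\mathbf w)=\Big(\sum_{j=0}^d s_j(\mathbf q)\Big)s_n(\mathbf w)=\Big(\sum_{j=0}^d h_j(\mathbf q)\Big)h_n(\mathbf w).$$ 2. $$\mathcal{M}_{p_d}(\mathbf q,\mathbf w)=\Big(\sum_{j=0}^d s_j(\mathbf q)\Big)s_n(\mathbf w)+\Big(\sum_{j=1}^{d-1}s_j(\mathbf q)\Big)s_{n-1,1}(\mathbf w)=\big(1+h_d(\mathbf q)\big)h_n(\mathbf w)+\Big(\sum_{j=1}^{d-1}h_j(\mathbf q)\Big)h_{n-1,1}(\mathbf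 w).$$ 3. If moreover $d\le n$ (that is, $e_d\ne 0$), then $$\mathcal{M}_{e_d}(\mathbf q,\mathbf w)=\sum_{i=0}^{\lfloor d/2\rfloor}\Big(\sum_{j=i}^{d-i}s_j(\mathbf q)\Big)s_{n-i,i}(\mathbf w)=\sum_{i=0}^{\lfloor d/2\rfloor}h_{n-i,i}(\mathbf w)\,h_i(\mathbf q)+\sum_{i=\lfloor d/2\rfloor+1}^{d}h_{n-d+i,d-i}(\mathbf w)\,h_i(\mathbf q).$$ -/

import Mathlib

namespace Polarization

noncomputable section

/-! ### Polynomials in `ℓ` sets of `n` variables -/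

/-- The ring of polynomials in the entries `x_{ij}` of an `ℓ × n` matrix of variables. -/
abbrev Poly (K : Type*) [Field K] (ℓ n : ℕ) : Type _ := MvPolynomial (Fin ℓ × Fin n) K

variable {K : Type*} [Field K] {ℓ n : ℕ}

/-- The diagonal action of `σ` on polynomials, as a linear map: `x_{ij} ↦ x_{i,σ(j)}`. -/
def diagAct (σ : Equiv.Perm (Fin n)) : Poly K ℓ n →ₗ[K] Poly K ℓ n :=
  (MvPolynomial.rename (R := K) fun x : Fin ℓ × Fin n => (x.1, σ x.2)).toLinearMap

variable (K ℓ n) in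
/-- The diagonal action of `𝔖_n` as a representation. -/
def diagRep : Representation K (Equiv.Perm (Fin n)) (Poly K ℓ n) where
  toFun σ := diagAct σ
  map_one' := by
    refine LinearMap.ext fun f => ?_
    exact MvPolynomial.rename_id_apply f
  map_mul' σ τ := by
    refine LinearMap.ext fun f => ?_
    simp [diagAct, MvPolynomial.rename_rename, Function.comp_def]

/-- The partial derivative `∂_{ij}`. -/
def partialDeriv (i : Fin ℓ) (j : Fin n) : Poly K ℓ n →ₗ[K] Poly K ℓ n :=
  (MvPolynomial.pderiv (R := K) (i, j)).toLinearMap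

/-- The generalized polarization operator `E_{i,k}^{(p)} = ∑_j x_{ij} ∂_{kj}^p`. -/
def polarizationOp (i k : Fin ℓ) (p : ℕ) : Poly K ℓ n →ₗ[K] Poly K ℓ n :=
  ∑ j : Fin n, LinearMap.mulLeft K (MvPolynomial.X (i, j)) ∘ₗ (partialDeriv k j ^ p)

def ClosedUnderDerivatives (V : Submodule K (Poly K ℓ n)) : Prop :=
  ∀ (i : Fin ℓ) (j : Fin n), ∀ g ∈ V, partialDeriv i j g ∈ V

def ClosedUnderPolarization (V : Submodule K (Poly K ℓ n)) : Prop :=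
  ∀ (i k : Fin ℓ) (p : ℕ), 1 ≤ p → ∀ g ∈ V, polarizationOp i k p g ∈ V

/-- Stability of a family of polynomials under the diagonal action. -/
def IsStable (F : Set (Poly K ℓ n)) : Prop :=
  ∀ σ : Equiv.Perm (Fin n), ∀ f ∈ F, diagRep K ℓ n σ f ∈ F

/-- The smallest subspace containing `F` which is closed under derivatives and polarization. -/
def polarizationSpan (F : Set (Poly K ℓ n)) : Submodule K (Poly K ℓ n) :=
  sInf {V | F ⊆ (V : Set (Poly K ℓ n)) ∧ ClosedUnderDerivatives V ∧ ClosedUnderPolarization V}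

theorem partialDeriv_diagRep (σ : Equiv.Perm (Fin n)) (i : Fin ℓ) (j : Fin n) (f : Poly K ℓ n) :
    partialDeriv i (σ j) (diagRep K ℓ n σ f) = diagRep K ℓ n σ (partialDeriv i j f) := by
  have hinj : Function.Injective fun x : Fin ℓ × Fin n => (x.1, σ x.2) := by
    rintro ⟨a, b⟩ ⟨c, e⟩ h
    simpa using h
  exact MvPolynomial.pderiv_rename hinj (x := (i, j)) (p := f)

theorem partialDeriv_pow_diagRep (σ : Equiv.Perm (Fin n)) (i : Fin ℓ) (j : Fin n) (p : ℕ)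
    (f : Poly K ℓ n) :
    (partialDeriv i (σ j) ^ p) (diagRep K ℓ n σ f)
      = diagRep K ℓ n σ ((partialDeriv i j ^ p) f) := by
  induction p with
  | zero => simp
  | succ p ih => rw [pow_succ', pow_succ', Module.End.mul_apply, Module.End.mul_apply, ih,
      partialDeriv_diagRep]

theorem polarizationOp_diagRep (σ : Equiv.Perm (Fin n)) (i k : Fin ℓ) (p : ℕ) (f : Poly K ℓ n) :
    polarizationOp i k p (diagRep K ℓ n σ f) = diagRep K ℓ n σ (polarizationOp i k p f) := by
  simp only [polarizationOp, LinearMap.sum_apply, LinearMap.comp_apply, LinearMap.mulLeft_apply,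
    map_sum]
  rw [← Equiv.sum_comp σ]
  refine Finset.sum_congr rfl fun j _ => ?_
  rw [partialDeriv_pow_diagRep]
  simp [diagRep, diagAct]

/-- The polarization module `M_F` generated by a stable family `F`, as a representation of `𝔖_n`
(with the diagonal action). -/
def polarizationModule (F : Set (Poly K ℓ n)) (hF : IsStable F) :
    Subrepresentation (diagRep K ℓ n) where
  toSubmodule := polarizationSpan F
  apply_mem_toSubmodule σ v hv := by
    refine Submodule.mem_sInf.2 fun V hV => ?_
    have key : V.comap (diagRep K ℓ n σ) ∈ {V : Submodule K (Poly K ℓ n) |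
        F ⊆ (V : Set (Poly K ℓ n)) ∧ ClosedUnderDerivatives V ∧ ClosedUnderPolarization V} := by
      refine ⟨fun f hf => hV.1 (hF σ f hf), fun i j g hg => ?_, fun i k p hp g hg => ?_⟩
      · rw [Submodule.mem_comap, ← partialDeriv_diagRep]
        exact hV.2.1 _ _ _ hg
      · rw [Submodule.mem_comap, ← polarizationOp_diagRep]
        exact hV.2.2 _ _ _ hp _ hg
    exact Submodule.mem_sInf.1 hv _ key

theorem isStable_orbit (f : Poly K ℓ n) :
    IsStable (Set.range fun σ : Equiv.Perm (Fin n) => diagRep K ℓ n σ f) := by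
  rintro σ _ ⟨τ, rfl⟩
  exact ⟨σ * τ, by simp⟩

/-- The polarization module `M_f` generated by a single polynomial `f`: the one generated by the
orbit of `f`. -/
def polarizationModuleOf (f : Poly K ℓ n) : Subrepresentation (diagRep K ℓ n) :=
  polarizationModule _ (isStable_orbit f)

/-! ### Multigraded components -/

/-- The vector degree of the variable `x_{ij}`: the `i`-th unit vector of `ℕ^ℓ`. -/
def rowWeight (x : Fin ℓ × Fin n) : Fin ℓ →₀ ℕ := Finsupp.single x.1 1

variable (K ℓ n) in
/-- The span of the monomials of vector degree `δ`, as a representation of `𝔖_n`. -/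
def homogeneousPart (δ : Fin ℓ →₀ ℕ) : Subrepresentation (diagRep K ℓ n) where
  toSubmodule := MvPolynomial.weightedHomogeneousSubmodule K rowWeight δ
  apply_mem_toSubmodule σ v hv := by
    rw [MvPolynomial.mem_weightedHomogeneousSubmodule] at hv ⊢
    intro c hc
    have hc' : MvPolynomial.coeff c
        (MvPolynomial.rename (fun x : Fin ℓ × Fin n => (x.1, σ x.2)) v) ≠ 0 := hc
    obtain ⟨u, rfl, hu⟩ := MvPolynomial.coeff_rename_ne_zero _ _ _ hc'
    rw [← hv hu, Finsupp.weight_apply, Finsupp.weight_apply,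
      Finsupp.sum_mapDomain_index (by simp) (by simp [add_smul])]
    rfl

/-- The component `V_δ = V ∩ R_δ` of degree `δ` of a stable subspace `V`. -/
def component (V : Subrepresentation (diagRep K ℓ n)) (δ : Fin ℓ →₀ ℕ) :
    Subrepresentation (diagRep K ℓ n) :=
  V ⊓ homogeneousPart K ℓ n δ

/-! ### Symmetric functions

Symmetric functions over `A` in variables indexed by `ι` (finitely or infinitely many) are
represented as formal power series. -/

/-- The power sum `p_k = ∑_i w_i^k`, for `k ≥ 1`. -/
def powerSum (ι A : Type*) [CommSemiring A] (k : ℕ) : MvPowerSeries ι A :=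
  open Classical in fun a => if ∃ i, a = Finsupp.single i k then 1 else 0

/-- The complete homogeneous symmetric function `h_k`, the sum of all monomials of degree `k`. -/
def completeHomog (ι A : Type*) [CommSemiring A] (k : ℕ) : MvPowerSeries ι A :=
  fun a => if a.degree = k then 1 else 0

/-- The number of semistandard Young tableaux of shape `μ` with `c k` entries equal to `k`. -/
def numTableaux (μ : YoungDiagram) (c : ℕ →₀ ℕ) : ℕ :=
  Nat.card {T : SemistandardYoungTableau μ //
    ∀ k : ℕ, (μ.cells.filter fun x => T x.1 x.2 = k).card = c k}

/-- The Schur function of shape `μ` in variables indexed by `ι`, the generating function of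
semistandard Young tableaux. The embedding `e` orders the variables and identifies them with the
allowed entries of the tableaux. -/
def schurDiagram {ι : Type*} (A : Type*) [CommSemiring A] (e : ι ↪ ℕ) (μ : YoungDiagram) :
    MvPowerSeries ι A :=
  fun a => (numTableaux μ (a.embDomain e) : A)

/-- The Schur function `s_λ` for a list `λ`; it is `0` if `λ` is not weakly decreasing. -/
def schur {ι : Type*} (A : Type*) [CommSemiring A] (e : ι ↪ ℕ) (l : List ℕ) : MvPowerSeries ι A :=
  open Classical in
  if h : l.SortedGE then schurDiagram A e (YoungDiagram.ofRowLens l h) else 0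

/-- The ring containing symmetric functions in `w = (w_0, w_1, …)`. -/
abbrev SeriesW (K : Type*) [Field K] : Type _ := MvPowerSeries ℕ K

/-- Formal power series in `q = (q_1, …, q_ℓ)` with coefficients in `SeriesW K`. -/
abbrev SeriesQW (K : Type*) [Field K] (ℓ : ℕ) : Type _ := MvPowerSeries (Fin ℓ) (SeriesW K)

variable (K) in
/-- `h_k(w)`. -/
def hW (ℓ k : ℕ) : SeriesQW K ℓ := MvPowerSeries.C (completeHomog ℕ K k)

variable (K) in
/-- `s_λ(w)`. -/
def sW (ℓ : ℕ) (l : List ℕ) : SeriesQW K ℓ :=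
  MvPowerSeries.C (schur K (Function.Embedding.refl ℕ) l)

variable (K) in
/-- `h_k(q)`. -/
def hQ (ℓ k : ℕ) : SeriesQW K ℓ := completeHomog (Fin ℓ) (SeriesW K) k

variable (K) in
/-- `s_k(q)`, the Schur function of the one-row shape `(k)`. -/
def sQ (ℓ k : ℕ) : SeriesQW K ℓ := schur (SeriesW K) Fin.valEmbedding [k]

variable (K) in
/-- `p_{λ(σ)}(w)`, where `λ(σ)` is the cycle type of `σ` (fixed points included). -/
def cyclePowerSum (σ : Equiv.Perm (Fin n)) : SeriesW K :=
  (σ.partition.parts.map (powerSum ℕ K)).prod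

/-- The graded Frobenius characteristic
`V(q,w) = ∑_δ ((1/n!) ∑_σ χ_{V_δ}(σ) p_{λ(σ)}(w)) q^δ`. -/
def frobeniusChar (V : Subrepresentation (diagRep K ℓ n)) : SeriesQW K ℓ :=
  fun δ => ((n.factorial : K)⁻¹) •
    ∑ σ : Equiv.Perm (Fin n),
      (component V δ).toRepresentation.character σ • cyclePowerSum K σ

/-- A polynomial in `n` variables evaluated at the set of variables `x_{i1}, …, x_{in}`. -/
def inRow (i : Fin ℓ) (f : MvPolynomial (Fin n) K) : Poly K ℓ n :=
  MvPolynomial.rename (fun j => (i, j)) f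

end

end Polarization

/-! Each of the three modules has an explicit multihomogeneous spanning set that `𝔖_n` permutes. For
`p₁^d` it consists of the monomials of degree at most `d` in the row sums `∑_j x_{ij}`, all fixed by
`𝔖_n`. For `p_d` it consists of the monomials of degree less than `d` in the variables of a single
column, together with the sums over all columns of the monomials of degree `d`. For `e_d` it
consists of the polarized elementary polynomials `polarizedEsymm K δ S`, which use only columns
outside `S`, with `|S| + |δ| = d`. Closure of these spans is a direct computation. Conversely, the
operators `E_{i,k}^{(1)}` and the derivatives reach every spanning vector from the generator, up to
positive integer factors that are invertible in characteristic zero.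

Every nonzero component of degree `δ` is then the permutation module on the `b`-subsets of the
columns for some `b`, and its Frobenius characteristic is `h_{n-b} h_b`
(`coeff_frobeniusChar_of_basis`, by Burnside's lemma). For powers of `p₁` only `b = 0` occurs. For
`p_d` it is `b = 0` in degrees `0` and `d`, and `b = 1` between.

For `e_d` the vectors of degree `δ` are indexed by the `(d - |δ|)`-subsets, and they need not be
independent. The tool is that the disjointness matrix between `a`-subsets and `b`-subsets has full
rank when `a ≤ b` and `a + b ≤ n` (`eq_zero_of_sum_disjoint_eq_zero`). It gives independence when `d
- |δ| ≤ |δ|`. In the opposite case it shows that the span has a basis indexed by the `|δ|`-subsets.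

The Schur forms follow from the two-row Jacobi–Trudi identity `schur_pair_add`, proved by exchanging
tails of words. It telescopes to `h_{n-b} h_b = ∑_{i ≤ b} s_{n-i,i}`. -/

namespace Polarization

noncomputable section

section Colourings

/-! ### Colourings and Burnside's lemma -/

/-- The content of a colouring: how often each colour occurs. -/
def content {X A : Type*} [Fintype X] (f : X → A) : A →₀ ℕ := ∑ j, Finsupp.single (f j) 1

theorem content_apply {X A : Type*} [Fintype X] (f : X → A) (a : A) :
    content f a = Nat.card {j // f j = a} := by
  classical
  simp [content, Finsupp.finsetSum_apply, Finsupp.single_apply, Nat.card_eq_fintype_card,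
    Fintype.card_subtype]

theorem content_comp_equiv {X Y A : Type*} [Fintype X] [Fintype Y] (f : X → A) (σ : Y ≃ X) :
    content (f ∘ σ) = content f :=
  Equiv.sum_comp σ fun j => Finsupp.single (f j) 1

/-- Equal contents mean equinumerous fibres over each colour, and bijections between the fibres glue
to a permutation. -/
theorem exists_perm_of_content_eq {X A : Type*} [Fintype X] {f g : X → A}
    (h : content f = content g) : ∃ σ : Equiv.Perm X, g ∘ σ = f := by
  have e : ∀ a, Nonempty ({j // f j = a} ≃ {j // g j = a}) := fun a => by
    rw [← Finite.card_eq, ← content_apply, ← content_apply, h]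
  refine ⟨Equiv.ofFiberEquiv fun a => (e a).some, funext fun j => ?_⟩
  exact Equiv.ofFiberEquiv_map _ j

theorem exists_content_eq {A : Type*} {n : ℕ} (C : A →₀ ℕ) (hC : C.degree = n) :
    ∃ f : Fin n → A, content f = C := by
  classical
  obtain ⟨l, hl⟩ := Quot.exists_rep (Finsupp.toMultiset C)
  have hlen : l.length = n := by
    have := congrArg Multiset.card hl
    rw [Finsupp.card_toMultiset] at this
    rw [← hC, Finsupp.degree_apply]
    simpa [Finsupp.sum] using this
  subst hlen
  refine ⟨l.get, ?_⟩
  apply AddEquiv.injective Multiset.toFinsupp.symm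
  change Finsupp.toMultiset _ = Finsupp.toMultiset C
  rw [← hl, content, map_sum]
  simp only [Finsupp.toMultiset_single, one_smul]
  have : (∑ j, ({l.get j} : Multiset A)) = Multiset.map l.get Finset.univ.val := by
    rw [Finset.sum, ← Multiset.sum_map_singleton (Multiset.map l.get _), Multiset.map_map]; rfl
  rw [this]
  simp [Fin.univ_val_map]

/-- There may be infinitely many colours, but only those in the support of `C` can occur. -/
instance finite_content {X A : Type*} [Fintype X] (C : A →₀ ℕ) :
    Finite {h : X → A // content h = C} := by
  classical
  have : ∀ h : {h : X → A // content h = C}, ∀ j, h.1 j ∈ C.support := fun h j => by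
    have hj := content_apply h.1 (h.1 j)
    rw [h.2] at hj
    rw [Finsupp.mem_support_iff, hj]
    have : Nonempty {i // h.1 i = h.1 j} := ⟨⟨j, rfl⟩⟩
    exact Nat.card_pos.ne'
  refine Finite.of_injective (β := X → C.support) (fun h j => ⟨h.1 j, this h j⟩) ?_
  intro h h' e
  ext j
  exact congrArg Subtype.val (congrFun e j)

/-- Permutations act on the colourings with a given content. -/
abbrev contentAction {X A : Type*} [Fintype X] (C : A →₀ ℕ) :
    MulAction (Equiv.Perm X) {h : X → A // content h = C} where
  smul σ h := ⟨h.1 ∘ ⇑σ⁻¹, by rw [content_comp_equiv, h.2]⟩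
  one_smul h := rfl
  mul_smul σ τ h := by
    apply Subtype.ext
    change h.1 ∘ ⇑(σ * τ)⁻¹ = (h.1 ∘ ⇑τ⁻¹) ∘ ⇑σ⁻¹
    rw [mul_inv_rev]
    rfl

/-- The colourings of content `C` form a single nonempty orbit, so by Burnside's lemma a permutation
fixes one of them on average. -/
theorem sum_card_invariant_content {A : Type*} {n : ℕ} (C : A →₀ ℕ) (hC : C.degree = n) :
    ∑ σ : Equiv.Perm (Fin n), Nat.card {h : Fin n → A // h ∘ σ = h ∧ content h = C}
      = n.factorial := by
  classical
  let := contentAction (X := Fin n) C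
  let := Fintype.ofFinite {h : Fin n → A // content h = C}
  have hne : Nonempty {h : Fin n → A // content h = C} := by
    obtain ⟨f, hf⟩ := exists_content_eq C hC
    exact ⟨⟨f, hf⟩⟩
  have htr : MulAction.IsPretransitive (Equiv.Perm (Fin n)) {h : Fin n → A // content h = C} := by
    refine ⟨fun f g => ?_⟩
    obtain ⟨σ, hσ⟩ := exists_perm_of_content_eq (f.2.trans g.2.symm)
    refine ⟨σ, Subtype.ext ?_⟩
    change f.1 ∘ ⇑σ⁻¹ = g.1
    rw [← hσ]
    funext j
    simp
  have hB := MulAction.sum_card_fixedBy_eq_card_orbits_mul_card_group (Equiv.Perm (Fin n))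
    {h : Fin n → A // content h = C}
  have hss : Subsingleton (Quotient (MulAction.orbitRel (Equiv.Perm (Fin n))
      {h : Fin n → A // content h = C})) :=
    MulAction.pretransitive_iff_subsingleton_quotient _ _ |>.1 htr
  have hone : Fintype.card (Quotient (MulAction.orbitRel (Equiv.Perm (Fin n))
      {h : Fin n → A // content h = C})) = 1 := by
    refine le_antisymm (Fintype.card_le_one_iff_subsingleton.2 hss) ?_
    exact Fintype.card_pos_iff.2 (hne.map fun x => Quotient.mk _ x)
  rw [hone, one_mul, Fintype.card_perm, Fintype.card_fin] at hB
  rw [← hB]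
  refine Finset.sum_congr rfl fun σ _ => ?_
  rw [← Nat.card_eq_fintype_card]
  refine Nat.card_congr ⟨fun h => ⟨⟨h.1, h.2.2⟩, ?_⟩, fun h => ⟨h.1.1, ?_, h.1.2⟩,
    fun _ => rfl, fun _ => rfl⟩
  · apply Subtype.ext
    change h.1 ∘ ⇑σ⁻¹ = h.1
    conv_lhs => rw [← h.2.1]
    funext j
    simp
  · have : h.1.1 ∘ ⇑σ⁻¹ = h.1.1 := congrArg Subtype.val h.2
    conv_lhs => rw [← this]
    funext j
    simp

/-! ### Power sums and invariant colourings -/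

theorem coeff_powerSum {ι A : Type*} [CommSemiring A] (k : ℕ) (a : ι →₀ ℕ) :
    open Classical in
    MvPowerSeries.coeff a (powerSum ι A k) = if ∃ i, a = Finsupp.single i k then 1 else 0 := rfl

/-- Expanding the product means choosing a variable `g q` in each factor. The condition `s q ≠ 0`
makes different choices give different exponents. -/
theorem coeff_prod_powerSum {ι A Q : Type*} [CommSemiring A] [Fintype Q] (s : Q → ℕ)
    (hs : ∀ q, s q ≠ 0) (c : ι →₀ ℕ) :
    MvPowerSeries.coeff c (∏ q, powerSum ι A (s q))
      = (Nat.card {g : Q → ι // ∑ q, Finsupp.single (g q) (s q) = c} : A) := by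
  classical
  rw [MvPowerSeries.coeff_prod]
  simp only [coeff_powerSum, Finset.prod_ite_zero, Finset.prod_const_one, Finset.mem_univ,
    true_implies]
  rw [Finset.sum_boole]
  congr 1
  symm
  rw [← Nat.card_eq_finsetCard]
  refine Nat.card_congr (Equiv.ofBijective (fun g => ⟨Finsupp.equivFunOnFinite.symm
    fun q => Finsupp.single (g.1 q) (s q), ?_⟩) ⟨?_, ?_⟩)
  · rw [Finset.mem_filter, Finset.mem_finsuppAntidiag]
    exact ⟨⟨g.2, Finset.subset_univ _⟩, fun q => ⟨g.1 q, rfl⟩⟩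
  · intro g g' h
    apply Subtype.ext
    funext q
    have := DFunLike.congr_fun (congrArg Subtype.val h) q
    exact (Finsupp.single_left_inj (hs q)).1 this
  · rintro ⟨l, hl⟩
    rw [Finset.mem_filter, Finset.mem_finsuppAntidiag] at hl
    choose g hg using hl.2
    refine ⟨⟨g, ?_⟩, ?_⟩
    · rw [← hl.1.1]
      exact Finset.sum_congr rfl fun q _ => (hg q).symm
    · apply Subtype.ext
      ext1 q
      exact (hg q).symm

/-- Turns the cycle type into a family indexed by the orbits of `σ`, so that `p_{λ(σ)}` becomes a
product over the quotient. Orbits of moved points match the cycle factors, and the remaining orbits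
are singletons. -/
theorem parts_partition_eq_map_card {α : Type*} [Fintype α] [DecidableEq α] (σ : Equiv.Perm α)
    [Fintype (Quotient (Equiv.Perm.SameCycle.setoid σ))] :
    σ.partition.parts = (Finset.univ : Finset (Quotient (Equiv.Perm.SameCycle.setoid σ))).val.map
      fun q => Nat.card {j // (Quotient.mk _ j : Quotient (Equiv.Perm.SameCycle.setoid σ)) = q} := by
  classical
  set s : Quotient (Equiv.Perm.SameCycle.setoid σ) → ℕ := fun q =>
    Nat.card {j // (Quotient.mk _ j : Quotient (Equiv.Perm.SameCycle.setoid σ)) = q} with hs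
  have hmk : ∀ (q : Quotient (Equiv.Perm.SameCycle.setoid σ)) (j : α),
      Quotient.mk _ j = q ↔ σ.SameCycle j q.out := fun q j => by
    rw [← Quotient.out_eq q, Quotient.eq]
    simp only [Quotient.out_eq]
    rfl
  set p : Quotient (Equiv.Perm.SameCycle.setoid σ) → Prop := fun q => σ q.out ≠ q.out with hp
  have hmoved : ((Finset.univ.filter p).val.map s) = σ.cycleType := by
    have himg : σ.cycleFactorsFinset = (Finset.univ.filter p).image fun q => σ.cycleOf q.out := by
      ext c
      simp only [Finset.mem_image, Finset.mem_filter, Finset.mem_univ, true_and]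
      constructor
      · intro hc
        have hcy := (Equiv.Perm.mem_cycleFactorsFinset_iff.1 hc).1
        obtain ⟨a, ha, -⟩ := id hcy
        have hac : c = σ.cycleOf a :=
          Equiv.Perm.cycle_is_cycleOf (Equiv.Perm.mem_support.2 ha) hc
        have hsame := (hmk (Quotient.mk _ a) a).1 rfl
        have hce := hsame.cycleOf_eq
        refine ⟨Quotient.mk _ a, ?_, (hac.trans hce).symm⟩
        have := Equiv.Perm.cycleOf_mem_cycleFactorsFinset_iff.1 (hac.trans hce ▸ hc)
        exact Equiv.Perm.mem_support.1 this
      · rintro ⟨q, hq, rfl⟩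
        exact Equiv.Perm.cycleOf_mem_cycleFactorsFinset_iff.2 (Equiv.Perm.mem_support.2 hq)
    have hinj : Set.InjOn (fun q : Quotient (Equiv.Perm.SameCycle.setoid σ) => σ.cycleOf q.out)
        (Finset.univ.filter p) := by
      intro q hq q' hq' h
      have hq : σ q.out ≠ q.out := by simpa [hp] using hq
      have h1 : q.out ∈ (σ.cycleOf q'.out).support := by
        rw [← show σ.cycleOf q.out = σ.cycleOf q'.out from h, Equiv.Perm.mem_support_cycleOf_iff]
        exact ⟨Equiv.Perm.SameCycle.refl _ _, Equiv.Perm.mem_support.2 hq⟩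
      rw [Equiv.Perm.mem_support_cycleOf_iff] at h1
      rw [← Quotient.out_eq q, hmk]
      exact h1.1.symm
    rw [Equiv.Perm.cycleType_def, himg, Finset.image_val_of_injOn hinj, Multiset.map_map]
    refine Multiset.map_congr rfl fun q hq => ?_
    have hq : σ q.out ≠ q.out := by simpa [hp] using hq
    rw [hs, Function.comp_apply, Function.comp_apply, ← Nat.card_eq_finsetCard]
    refine Nat.card_congr (Equiv.subtypeEquivRight fun j => ?_)
    rw [hmk, Equiv.Perm.mem_support_cycleOf_iff, Equiv.Perm.sameCycle_comm]
    exact ⟨fun h => ⟨h, Equiv.Perm.mem_support.2 hq⟩, fun h => h.1⟩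
  have hfixed : ∀ q ∈ (Finset.univ.filter fun q => ¬ p q).val, s q = 1 := by
    intro q hq
    have hq : σ q.out = q.out := by simpa [hp] using hq
    rw [hs, Nat.card_eq_one_iff_unique]
    refine ⟨⟨fun a b => Subtype.ext ?_⟩, ⟨⟨q.out, Quotient.out_eq q⟩⟩⟩
    have key : ∀ a, (Quotient.mk _ a : Quotient (Equiv.Perm.SameCycle.setoid σ)) = q →
        a = q.out := fun a ha => by
      obtain ⟨k, hk⟩ := ((hmk q a).1 ha).symm
      rw [← hk]
      exact (Equiv.Perm.zpow_apply_eq_self_of_apply_eq_self hq k)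
    rw [key a.1 a.2, key b.1 b.2]
  have hsplit : (Finset.univ : Finset (Quotient (Equiv.Perm.SameCycle.setoid σ))).val.map s
      = (Finset.univ.filter p).val.map s + (Finset.univ.filter fun q => ¬ p q).val.map s := by
    rw [← Multiset.map_add, Finset.filter_val, Finset.filter_val, Multiset.filter_add_not]
  -- The orbit sizes add up to the number of points, which determines how many parts equal to `1`
  -- there are.
  have htot : ((Finset.univ : Finset (Quotient (Equiv.Perm.SameCycle.setoid σ))).val.map s).sum
      = Fintype.card α := by
    rw [← Nat.card_eq_fintype_card, Nat.card_congr (Equiv.sigmaFiberEquiv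
      (Quotient.mk (Equiv.Perm.SameCycle.setoid σ))).symm, Nat.card_sigma]
    rfl
  rw [Multiset.map_congr rfl hfixed, Multiset.map_const'] at hsplit
  rw [hsplit, hmoved] at htot ⊢
  rw [Equiv.Perm.parts_partition]
  simp only [Multiset.sum_add, Equiv.Perm.sum_cycleType, Multiset.sum_replicate, smul_eq_mul,
    mul_one] at htot
  congr 2
  omega

/-- A `σ`-invariant colouring is a function on the cycles of `σ`, and a cycle of length `k` with
colour `v` contributes `w_v^k`. -/
theorem coeff_cyclePowerSum {K : Type*} [Field K] {n : ℕ} (σ : Equiv.Perm (Fin n)) (c : ℕ →₀ ℕ) :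
    MvPowerSeries.coeff c (cyclePowerSum K σ)
      = (Nat.card {f : Fin n → ℕ // f ∘ σ = f ∧ content f = c} : K) := by
  classical
  let := Fintype.ofFinite (Quotient (Equiv.Perm.SameCycle.setoid σ))
  have hpos : ∀ q : Quotient (Equiv.Perm.SameCycle.setoid σ), Nat.card {j //
      (Quotient.mk _ j : Quotient (Equiv.Perm.SameCycle.setoid σ)) = q} ≠ 0 := fun q =>
    have : Nonempty {j // (Quotient.mk _ j : Quotient (Equiv.Perm.SameCycle.setoid σ)) = q} :=
      ⟨⟨q.out, Quotient.out_eq q⟩⟩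
    Nat.card_pos.ne'
  rw [cyclePowerSum, parts_partition_eq_map_card, Multiset.map_map]
  refine (coeff_prod_powerSum _ hpos c).trans (congrArg Nat.cast (Nat.card_congr ?_))
  have hcontent : ∀ g : Quotient (Equiv.Perm.SameCycle.setoid σ) → ℕ,
      ∑ q, Finsupp.single (g q) (Nat.card {j //
        (Quotient.mk _ j : Quotient (Equiv.Perm.SameCycle.setoid σ)) = q})
        = content (g ∘ Quotient.mk (Equiv.Perm.SameCycle.setoid σ)) := fun g => by
    rw [content, ← Finset.sum_fiberwise_of_maps_to
      (g := Quotient.mk (Equiv.Perm.SameCycle.setoid σ)) (t := Finset.univ) (by simp)]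
    refine Finset.sum_congr rfl fun q _ => ?_
    rw [Finset.sum_congr rfl (g := fun _ => Finsupp.single (g q) 1)
      (fun j hj => by simp [(Finset.mem_filter.1 hj).2])]
    rw [Finset.sum_const, Finsupp.smul_single, smul_eq_mul, mul_one, Nat.card_eq_fintype_card,
      Fintype.card_subtype]
  refine Equiv.ofBijective (fun g => ⟨g.1 ∘ Quotient.mk _, ?_, (hcontent g.1).symm.trans g.2⟩)
    ⟨?_, ?_⟩
  · funext j
    refine congrArg g.1 (Quotient.sound ?_)
    exact ⟨-1, by simp⟩
  · intro g g' h
    apply Subtype.ext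
    funext q
    induction q using Quotient.inductionOn with
    | h j => exact congrFun (congrArg Subtype.val h) j
  · rintro ⟨f, hf, hc⟩
    have hpow : ∀ (k : ℕ) (j), f ((σ ^ k) j) = f j := fun k j => by
      induction k with
      | zero => rfl
      | succ k ih => rw [pow_succ', Equiv.Perm.mul_apply, ← ih]; exact congrFun hf _
    have hsame : ∀ a b, σ.SameCycle a b → f a = f b := fun a b hab => by
      obtain ⟨k, -, hk⟩ := hab.exists_pow_eq'
      rw [← hk, hpow]
    exact ⟨⟨Quotient.lift f hsame, (hcontent _).trans hc⟩, rfl⟩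

/-! ### The Frobenius characteristic of the permutation representation on `b`-subsets -/

theorem sumFinsupp_content {X A B : Type*} [Fintype X] (h : X → A ⊕ B) :
    (Finsupp.sumFinsuppEquivProdFinsupp (content h)).1
        = ∑ j, (h j).elim (fun a => Finsupp.single a 1) 0 ∧
      (Finsupp.sumFinsuppEquivProdFinsupp (content h)).2
        = ∑ j, (h j).elim 0 (fun b => Finsupp.single b 1) := by
  classical
  constructor <;> ext v
  · rw [Finsupp.fst_sumFinsuppEquivProdFinsupp, content, Finsupp.finsetSum_apply,
      Finsupp.finsetSum_apply]
    refine Finset.sum_congr rfl fun j _ => ?_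
    rcases h j with a | b <;> simp [Finsupp.single_apply]
  · rw [Finsupp.snd_sumFinsuppEquivProdFinsupp, content, Finsupp.finsetSum_apply,
      Finsupp.finsetSum_apply]
    refine Finset.sum_congr rfl fun j _ => ?_
    rcases h j with a | b <;> simp [Finsupp.single_apply]

theorem sumFinsupp_content_add {X A : Type*} [Fintype X] (h : X → A ⊕ A) :
    (Finsupp.sumFinsuppEquivProdFinsupp (content h)).1
      + (Finsupp.sumFinsuppEquivProdFinsupp (content h)).2
        = content fun j => (h j).elim id id := by
  rw [(sumFinsupp_content h).1, (sumFinsupp_content h).2, ← Finset.sum_add_distrib]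
  refine Finset.sum_congr rfl fun j _ => ?_
  rcases hj : h j with a | b <;> simp [hj]

theorem degree_sumFinsupp_content_snd {X A B : Type*} [Fintype X] (h : X → A ⊕ B) :
    (Finsupp.sumFinsuppEquivProdFinsupp (content h)).2.degree
      = (Finset.univ.filter fun j => (h j).isRight).card := by
  rw [(sumFinsupp_content h).2, map_sum, Finset.card_filter]
  refine Finset.sum_congr rfl fun j _ => ?_
  rcases h j with a | b <;> simp

theorem degree_sumFinsupp_content_fst {X A B : Type*} [Fintype X] (h : X → A ⊕ B) :
    (Finsupp.sumFinsuppEquivProdFinsupp (content h)).1.degree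
      = (Finset.univ.filter fun j => ¬ (h j).isRight).card := by
  rw [(sumFinsupp_content h).1, map_sum, Finset.card_filter]
  refine Finset.sum_congr rfl fun j _ => ?_
  rcases h j with a | b <;> simp

/-- The pairs `(c₁, c₂)` with `c₁ + c₂ = c`, `|c₁| = a`, `|c₂| = b`. -/
def contentSplittings (a b : ℕ) (c : ℕ →₀ ℕ) : Finset ((ℕ →₀ ℕ) × (ℕ →₀ ℕ)) :=
  (Finset.HasAntidiagonal.antidiagonal c).filter fun p => p.1.degree = a ∧ p.2.degree = b

theorem coeff_completeHomog_mul {K : Type*} [CommSemiring K] (a b : ℕ) (c : ℕ →₀ ℕ) :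
    MvPowerSeries.coeff c (completeHomog ℕ K a * completeHomog ℕ K b)
      = ((contentSplittings a b c).card : K) := by
  classical
  rw [MvPowerSeries.coeff_mul, contentSplittings, Finset.card_filter, Nat.cast_sum]
  refine Finset.sum_congr rfl fun p _ => ?_
  change (if p.1.degree = a then (1 : K) else 0) * (if p.2.degree = b then 1 else 0) = _
  split_ifs <;> simp_all

/-- A subset together with a colouring is a single colouring by `ℕ ⊕ ℕ`, where the right summand
marks membership in the subset. Invariance under `σ` holds for the pair exactly when it holds for
the combined colouring. -/
theorem card_subset_mul_card_coloring {n b : ℕ} (σ : Equiv.Perm (Fin n))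
    (c : ℕ →₀ ℕ) :
    Nat.card {S : Finset (Fin n) // S.card = b ∧ S.map σ.toEmbedding = S}
        * Nat.card {f : Fin n → ℕ // f ∘ σ = f ∧ content f = c}
      = ∑ p ∈ contentSplittings (n - b) b c, Nat.card {h : Fin n → ℕ ⊕ ℕ //
          h ∘ σ = h ∧ content h = Finsupp.sumFinsuppEquivProdFinsupp.symm p} := by
  classical
  have hfin : ∀ C : ℕ ⊕ ℕ →₀ ℕ, Finite {h : Fin n → ℕ ⊕ ℕ // h ∘ σ = h ∧ content h = C} := fun C =>
    Finite.of_injective (β := {h : Fin n → ℕ ⊕ ℕ // content h = C}) (fun h => ⟨h.1, h.2.2⟩)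
      fun h h' e => Subtype.ext (congrArg (fun x => x.1) e)
  rw [← Nat.card_prod, ← Finset.sum_coe_sort, ← Nat.card_sigma]
  symm
  have hmemS : ∀ (S : Finset (Fin n)), S.map σ.toEmbedding = S ↔ ∀ j, σ j ∈ S ↔ j ∈ S := by
    intro S
    constructor
    · intro h j
      conv_lhs => rw [← h]
      simp
    · intro h
      ext j
      rw [Finset.mem_map_equiv, ← h, Equiv.apply_symm_apply]
  refine Nat.card_congr (Equiv.ofBijective (fun x =>
    (⟨Finset.univ.filter fun j => (x.2.1 j).isRight, ?_, ?_⟩,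
      ⟨fun j => (x.2.1 j).elim id id, ?_, ?_⟩)) ⟨?_, ?_⟩)
  · rw [← degree_sumFinsupp_content_snd, x.2.2.2, Equiv.apply_symm_apply]
    exact ((Finset.mem_filter.1 x.1.2).2).2
  · rw [hmemS]
    intro j
    simp only [Finset.mem_filter, Finset.mem_univ, true_and]
    rw [show x.2.1 (σ j) = x.2.1 j from congrFun x.2.2.1 j]
  · funext j
    change (x.2.1 (σ j)).elim id id = _
    rw [show x.2.1 (σ j) = x.2.1 j from congrFun x.2.2.1 j]
  · rw [← sumFinsupp_content_add, x.2.2.2, Equiv.apply_symm_apply]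
    exact Finset.HasAntidiagonal.mem_antidiagonal.1 (Finset.mem_filter.1 x.1.2).1
  · rintro ⟨⟨p, hp⟩, ⟨h, h1, h2⟩⟩ ⟨⟨p', hp'⟩, ⟨h', h1', h2'⟩⟩ e
    simp only [Prod.mk.injEq, Subtype.mk.injEq] at e
    have hh : h = h' := by
      funext j
      have e1 := congrFun e.2 j
      have e2 : j ∈ Finset.univ.filter (fun j => (h j).isRight) ↔
          j ∈ Finset.univ.filter fun j => (h' j).isRight := by rw [e.1]
      simp only [Finset.mem_filter, Finset.mem_univ, true_and] at e2
      rcases hu : h j with u | u <;> rcases hv : h' j with v | v <;>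
        simp only [hu, hv] at e1 e2 <;> simp_all
    subst hh
    have hpp : p = p' := Finsupp.sumFinsuppEquivProdFinsupp.symm.injective (h2.symm.trans h2')
    subst hpp
    rfl
  · rintro ⟨⟨S, hS, hσ⟩, ⟨f, hf, hc⟩⟩
    rw [hmemS] at hσ
    let h : Fin n → ℕ ⊕ ℕ := fun j => if j ∈ S then Sum.inr (f j) else Sum.inl (f j)
    have hS' : (Finset.univ.filter fun j => (h j).isRight) = S := by
      ext j
      by_cases hj : j ∈ S <;> simp [h, hj]
    have hf' : (fun j => (h j).elim id id) = f := by
      funext j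
      by_cases hj : j ∈ S <;> simp [h, hj]
    have hinv : h ∘ σ = h := by
      funext j
      simp only [h, Function.comp_apply, hσ, show f (σ j) = f j from congrFun hf j]
    have hp : Finsupp.sumFinsuppEquivProdFinsupp (content h) ∈ contentSplittings (n - b) b c := by
      rw [contentSplittings, Finset.mem_filter, Finset.HasAntidiagonal.mem_antidiagonal,
        sumFinsupp_content_add,
        degree_sumFinsupp_content_snd, degree_sumFinsupp_content_fst, hf']
      refine ⟨hc, ?_, by rw [hS', hS]⟩
      rw [Finset.filter_not, Finset.card_sdiff_of_subset (Finset.subset_univ _), hS', hS]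
      simp
    refine ⟨⟨⟨_, hp⟩, ⟨h, hinv, (Equiv.symm_apply_apply _ _).symm⟩⟩, ?_⟩
    exact Prod.ext (Subtype.ext hS') (Subtype.ext hf')

theorem degree_embDomain {A B : Type*} (c : A →₀ ℕ) (e : A ↪ B) :
    (c.embDomain e).degree = c.degree := by
  simp [Finsupp.degree_apply, Finsupp.support_embDomain]

/-- Compare coefficients of `w^c`. After exchanging the sums, Burnside's lemma contributes `n!` for
each way to split `c` into parts of sizes `n - b` and `b`, and these splittings are what `h_{n-b}
h_b` counts. -/
theorem sum_card_smul_cyclePowerSum {K : Type*} [Field K] [CharZero K] {n b : ℕ} (hb : b ≤ n) :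
    ((n.factorial : K)⁻¹) • ∑ σ : Equiv.Perm (Fin n),
      (Nat.card {S : Finset (Fin n) // S.card = b ∧ S.map σ.toEmbedding = S} : K)
        • cyclePowerSum K σ
      = completeHomog ℕ K (n - b) * completeHomog ℕ K b := by
  ext c
  rw [coeff_completeHomog_mul, MvPowerSeries.coeff_smul, map_sum]
  simp only [MvPowerSeries.coeff_smul, coeff_cyclePowerSum, ← Nat.cast_mul,
    card_subset_mul_card_coloring]
  rw [← Nat.cast_sum, Finset.sum_comm, Finset.sum_congr rfl (g := fun _ => n.factorial)]
  · rw [Finset.sum_const, smul_eq_mul, Nat.cast_mul, mul_comm,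
      mul_inv_cancel_right₀ (Nat.cast_ne_zero.2 n.factorial_ne_zero)]
  · intro p hp
    apply sum_card_invariant_content
    obtain ⟨-, h1, h2⟩ := Finset.mem_filter.1 hp
    have : (Finsupp.sumFinsuppEquivProdFinsupp.symm p).degree = p.1.degree + p.2.degree := by
      rw [Finsupp.sumFinsuppEquivProdFinsupp_symm_apply, ← degree_embDomain p.1 .inl,
        ← degree_embDomain p.2 (.inr : ℕ ↪ ℕ ⊕ ℕ), ← map_add, Finsupp.embDomain_inl,
        Finsupp.embDomain_inr, ← Finsupp.sumElim_add, add_zero, zero_add]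
    omega

end Colourings

section Components

variable {K : Type*} [Field K] {ℓ n : ℕ}

/-! ### Characters of components -/

/-- The trace of a permutation matrix counts the fixed basis vectors. -/
theorem character_eq_card_fixed {X : Type*} [Finite X] (V : Subrepresentation (diagRep K ℓ n))
    (σ : Equiv.Perm (Fin n)) (act : X → X) (v : X → Poly K ℓ n) (hli : LinearIndependent K v)
    (hspan : V.toSubmodule = Submodule.span K (Set.range v))
    (hact : ∀ x, diagRep K ℓ n σ (v x) = v (act x)) :
    V.toRepresentation.character σ = (Nat.card {x // act x = x} : K) := by
  classical
  let := Fintype.ofFinite X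
  obtain ⟨W, hW⟩ := V
  change W = _ at hspan
  subst hspan
  rw [Representation.character, LinearMap.trace_eq_matrix_trace K (Module.Basis.span hli),
    Matrix.trace, Nat.card_eq_fintype_card, Fintype.card_subtype, Finset.card_filter, Nat.cast_sum]
  refine Finset.sum_congr rfl fun x _ => ?_
  have h1 : (⟨Submodule.span K (Set.range v), hW⟩ :
      Subrepresentation (diagRep K ℓ n)).toRepresentation σ (Module.Basis.span hli x)
        = Module.Basis.span hli (act x) := by
    apply Subtype.ext
    change diagRep K ℓ n σ (Module.Basis.span hli x : Submodule.span K (Set.range v)) = _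
    rw [Module.Basis.span_apply, Module.Basis.span_apply, hact]
  rw [Matrix.diag_apply, LinearMap.toMatrix_apply, h1, Module.Basis.repr_self,
    Finsupp.single_apply]
  split_ifs <;> simp

theorem coeff_frobeniusChar (V : Subrepresentation (diagRep K ℓ n)) (δ : Fin ℓ →₀ ℕ) :
    MvPowerSeries.coeff δ (frobeniusChar V) = ((n.factorial : K)⁻¹) •
      ∑ σ : Equiv.Perm (Fin n), (component V δ).toRepresentation.character σ • cyclePowerSum K σ :=
  rfl

/-- All nonzero components are computed through this lemma: `b = 0` is the trivial representation
and `b = 1` the permutation of the columns. Only the values of `v` on `b`-subsets matter. -/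
theorem coeff_frobeniusChar_of_basis [CharZero K] {b : ℕ} (hb : b ≤ n)
    (V : Subrepresentation (diagRep K ℓ n)) (δ : Fin ℓ →₀ ℕ) (v : Finset (Fin n) → Poly K ℓ n)
    (hli : LinearIndependent K fun S : {S : Finset (Fin n) // S.card = b} => v S)
    (hspan : (component V δ).toSubmodule = Submodule.span K (v '' {S | S.card = b}))
    (hact : ∀ (σ : Equiv.Perm (Fin n)) (S : Finset (Fin n)), S.card = b →
      diagRep K ℓ n σ (v S) = v (S.map σ.toEmbedding)) :
    MvPowerSeries.coeff δ (frobeniusChar V) = completeHomog ℕ K (n - b) * completeHomog ℕ K b := by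
  rw [← sum_card_smul_cyclePowerSum hb, coeff_frobeniusChar]
  congr 1
  refine Finset.sum_congr rfl fun σ _ => ?_
  congr 1
  rw [character_eq_card_fixed (X := {S : Finset (Fin n) // S.card = b}) _ σ
    (fun S => ⟨S.1.map σ.toEmbedding, by rw [Finset.card_map, S.2]⟩) _ hli _ fun S => hact σ _ S.2]
  · congr 1
    exact Nat.card_congr ⟨fun S => ⟨S.1.1, S.1.2, congrArg Subtype.val S.2⟩,
      fun S => ⟨⟨S.1, S.2.1⟩, Subtype.ext S.2.2⟩, fun _ => rfl, fun _ => rfl⟩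
  · rw [hspan]
    congr 1
    ext x
    simp

theorem coeff_frobeniusChar_of_bot (V : Subrepresentation (diagRep K ℓ n)) (δ : Fin ℓ →₀ ℕ)
    (h : (component V δ).toSubmodule = ⊥) :
    MvPowerSeries.coeff δ (frobeniusChar V) = 0 := by
  rw [coeff_frobeniusChar, Finset.sum_eq_zero, smul_zero]
  intro σ _
  rw [character_eq_card_fixed (X := Empty) (component V δ) σ id Empty.elim
    linearIndependent_empty_type (by rw [h, Set.range_eq_empty, Submodule.span_empty]) (fun x => x.elim)]
  simp

/-- The projection to degree `δ` fixes a homogeneous spanning vector or kills it, so it maps the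
span into the span of the vectors of degree `δ`. -/
theorem component_toSubmodule_of_span {ι : Type*} (v : ι → Poly K ℓ n) (w : ι → Fin ℓ →₀ ℕ)
    (hv : ∀ i, MvPolynomial.IsWeightedHomogeneous rowWeight (v i) (w i))
    (V : Subrepresentation (diagRep K ℓ n)) (hV : V.toSubmodule = Submodule.span K (Set.range v))
    (δ : Fin ℓ →₀ ℕ) :
    (component V δ).toSubmodule = Submodule.span K (v '' {i | w i = δ}) := by
  change V.toSubmodule ⊓ MvPolynomial.weightedHomogeneousSubmodule K rowWeight δ = _
  rw [hV]
  apply le_antisymm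
  · rintro f ⟨hf, hδ⟩
    -- Replacing `f` by its own projection makes the claim linear in `f`, so that span induction
    -- applies once homogeneity of `f` is forgotten.
    rw [← (show MvPolynomial.weightedHomogeneousComponent rowWeight δ f = f from
      MvPolynomial.IsWeightedHomogeneous.weightedHomogeneousComponent_same hδ)]
    clear hδ
    induction hf using Submodule.span_induction with
    | mem x hx =>
      obtain ⟨i, rfl⟩ := hx
      by_cases hi : w i = δ
      · rw [← hi, MvPolynomial.IsWeightedHomogeneous.weightedHomogeneousComponent_same (hv i)]
        exact Submodule.subset_span ⟨i, rfl, rfl⟩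
      · rw [MvPolynomial.IsWeightedHomogeneous.weightedHomogeneousComponent_ne δ (hv i) (Ne.symm hi)]
        exact Submodule.zero_mem _
    | zero => rw [map_zero]; exact Submodule.zero_mem _
    | add x y _ _ hx hy => rw [map_add]; exact Submodule.add_mem _ hx hy
    | smul a x _ hx => rw [map_smul]; exact Submodule.smul_mem _ _ hx
  · refine Submodule.span_le.2 ?_
    rintro _ ⟨i, rfl, rfl⟩
    exact ⟨Submodule.subset_span ⟨i, rfl⟩, hv i⟩

/-! ### Polarization spans -/

theorem polarizationSpan_le {F : Set (Poly K ℓ n)} {V : Submodule K (Poly K ℓ n)}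
    (hF : F ⊆ V) (hd : ClosedUnderDerivatives V) (hp : ClosedUnderPolarization V) :
    polarizationSpan F ≤ V :=
  sInf_le ⟨hF, hd, hp⟩

theorem subset_polarizationSpan (F : Set (Poly K ℓ n)) : F ⊆ polarizationSpan F :=
  fun _ hf => Submodule.mem_sInf.2 fun _ hV => hV.1 hf

theorem closedUnderDerivatives_polarizationSpan (F : Set (Poly K ℓ n)) :
    ClosedUnderDerivatives (polarizationSpan F) := fun i j g hg =>
  Submodule.mem_sInf.2 fun V hV => hV.2.1 i j g (Submodule.mem_sInf.1 hg V hV)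

theorem closedUnderPolarization_polarizationSpan (F : Set (Poly K ℓ n)) :
    ClosedUnderPolarization (polarizationSpan F) := fun i k p hp g hg =>
  Submodule.mem_sInf.2 fun V hV => hV.2.2 i k p hp g (Submodule.mem_sInf.1 hg V hV)

/-- To identify the module generated by a symmetric polynomial with a given span, it suffices
to check the closure properties on the spanning vectors. -/
theorem polarizationModuleOf_toSubmodule_eq_span (f : Poly K ℓ n)
    (hf : ∀ σ, diagRep K ℓ n σ f = f) (B : Set (Poly K ℓ n))
    (hfB : f ∈ Submodule.span K B)
    (hd : ∀ i j, ∀ g ∈ B, partialDeriv i j g ∈ Submodule.span K B)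
    (hp : ∀ i k p, 1 ≤ p → ∀ g ∈ B, polarizationOp i k p g ∈ Submodule.span K B)
    (hB : ∀ V : Submodule K (Poly K ℓ n), f ∈ V → ClosedUnderDerivatives V →
      ClosedUnderPolarization V → B ⊆ V) :
    (polarizationModuleOf f).toSubmodule = Submodule.span K B := by
  apply le_antisymm
  · refine polarizationSpan_le ?_ ?_ ?_
    · rintro _ ⟨σ, rfl⟩
      change diagRep K ℓ n σ f ∈ _
      rw [hf]
      exact hfB
    · intro i j g hg
      exact (Submodule.span_le (p := (Submodule.span K B).comap (partialDeriv i j))).2 (hd i j) hg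
    · intro i k p h1 g hg
      exact (Submodule.span_le (p := (Submodule.span K B).comap (polarizationOp i k p))).2
        (hp i k p h1) hg
  · refine Submodule.span_le.2 (hB _ ?_ (closedUnderDerivatives_polarizationSpan _)
      (closedUnderPolarization_polarizationSpan _))
    exact subset_polarizationSpan _ ⟨1, by simp⟩

/-- Induction over the vectors of degree `d` by moving units out of the coordinate `i₀`. -/
theorem degree_eq_induction {ι : Type*} [Finite ι] (i₀ : ι) (d : ℕ) {Q : (ι →₀ ℕ) → Prop}
    (h0 : Q (Finsupp.single i₀ d))
    (step : ∀ β i, Q (β + Finsupp.single i₀ 1) → Q (β + Finsupp.single i 1))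
    (α : ι →₀ ℕ) (hα : α.degree = d) : Q α := by
  classical
  -- The measure is the number of units outside `i₀`.
  induction hm : d - α i₀ generalizing α with
  | zero =>
    have hle : α i₀ ≤ d := hα ▸ Finsupp.le_degree i₀ α
    have hα0 : α = Finsupp.single i₀ d := by
      have h1 : Finsupp.single i₀ d ≤ α := by
        rw [Finsupp.single_le_iff]
        omega
      obtain ⟨γ, hγ⟩ := le_iff_exists_add.1 h1
      have : γ.degree = 0 := by
        have := congrArg Finsupp.degree hγ
        rw [map_add, Finsupp.degree_single] at this
        omega
      rw [hγ, (Finsupp.degree_eq_zero_iff γ).1 this, add_zero]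
    exact hα0 ▸ h0
  | succ m ih =>
    have : ∃ i, i ≠ i₀ ∧ α i ≠ 0 := by
      by_contra! hcon
      have : α = Finsupp.single i₀ (α i₀) := by
        ext i
        by_cases hi : i = i₀
        · simp [hi]
        · rw [hcon i hi, Finsupp.single_apply, if_neg (Ne.symm hi)]
      have h2 := congrArg Finsupp.degree this
      rw [Finsupp.degree_single] at h2
      omega
    obtain ⟨i, hi, hαi⟩ := this
    have h1 : Finsupp.single i 1 ≤ α := by
      rw [Finsupp.single_le_iff]
      omega
    obtain ⟨β, hβ⟩ := le_iff_exists_add'.1 h1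
    rw [hβ]
    refine step β i (ih _ ?_ ?_)
    · rw [← hα, hβ, map_add, map_add, Finsupp.degree_single, Finsupp.degree_single]
    · have : α i₀ = β i₀ := by
        rw [hβ, Finsupp.add_apply, Finsupp.single_apply, if_neg hi, add_zero]
      rw [Finsupp.add_apply, Finsupp.single_eq_same]
      omega

end Components

section TwoRowSchur

/-! ### Two-rowed Schur functions -/

/-- Pairs of weakly increasing words of lengths `a` and `b` with total content `c`. -/
def sortedPairs (a b : ℕ) (c : ℕ →₀ ℕ) : Set (List ℕ × List ℕ) :=
  {p | (p.1.Pairwise (· ≤ ·) ∧ p.2.Pairwise (· ≤ ·)) ∧ (p.1.length = a ∧ p.2.length = b) ∧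
    ∀ k, p.1.count k + p.2.count k = c k}

/-- The words of `p`, written below each other, are strictly increasing in columns. -/
def ColumnStrict (p : List ℕ × List ℕ) : Prop :=
  ∀ i (h₁ : i < p.1.length) (h₂ : i < p.2.length), p.1[i] < p.2[i]

/-- `j` is the first position where the column condition fails. -/
def CrossesAt (p : List ℕ × List ℕ) (j : ℕ) : Prop :=
  (j < p.2.length ∧ j ≤ p.1.length) ∧
    (∀ i (h₁ : i < p.1.length) (h₂ : i < p.2.length), i < j → p.1[i] < p.2[i]) ∧
    ∀ (h₁ : j < p.1.length) (h₂ : j < p.2.length), p.2[j] ≤ p.1[j]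

/-- Exchange of the tails of two words at the position `j`. -/
def swapTails (j : ℕ) (p : List ℕ × List ℕ) : List ℕ × List ℕ :=
  (p.1.take j ++ p.2.drop (j + 1), p.2.take (j + 1) ++ p.1.drop j)

theorem CrossesAt.unique {p : List ℕ × List ℕ} {i j : ℕ} (hi : CrossesAt p i)
    (hj : CrossesAt p j) : i = j := by
  obtain ⟨⟨hi1, hi2⟩, hi3, hi4⟩ := hi
  obtain ⟨⟨hj1, hj2⟩, hj3, hj4⟩ := hj
  rcases lt_trichotomy i j with h | h | h
  · exact absurd (hi4 (by omega) hi1) (not_le.2 (hj3 i (by omega) hi1 h))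
  · exact h
  · exact absurd (hj4 (by omega) hj1) (not_le.2 (hi3 j (by omega) hj1 h))

/-- If the second word is longer, the position just past the end of the first word is a failure as
well, because the final clause of `CrossesAt` is vacuous there. -/
theorem exists_crossesAt {p : List ℕ × List ℕ} (h : ¬ ColumnStrict p ∨ p.1.length < p.2.length) :
    ∃ j, CrossesAt p j := by
  classical
  have hex : ∃ j, (j < p.2.length ∧ j ≤ p.1.length) ∧
      ∀ (h₁ : j < p.1.length) (h₂ : j < p.2.length), p.2[j] ≤ p.1[j] := by
    rcases h with h | h
    · simp only [ColumnStrict, not_forall, not_lt] at h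
      obtain ⟨j, h1, h2, h3⟩ := h
      exact ⟨j, ⟨h2, h1.le⟩, fun _ _ => h3⟩
    · exact ⟨p.1.length, ⟨h, le_rfl⟩, fun h => absurd h (lt_irrefl _)⟩
  refine ⟨Nat.find hex, (Nat.find_spec hex).1, fun i h1 h2 hi => ?_, (Nat.find_spec hex).2⟩
  by_contra hcon
  exact Nat.find_min hex hi ⟨⟨h2, h1.le⟩, fun _ _ => not_lt.1 hcon⟩

theorem CrossesAt.not_columnStrict {p : List ℕ × List ℕ} {j : ℕ} (h : CrossesAt p j)
    (hl : p.2.length ≤ p.1.length) : ¬ ColumnStrict p := fun hc =>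
  have h1 : j < p.1.length := h.1.1.trans_le hl
  absurd (hc j h1 h.1.1) (not_lt.2 (h.2.2 h1 h.1.1))

theorem getElem_le_of_pairwise {l : List ℕ} (h : l.Pairwise (· ≤ ·)) {i j : ℕ} (hij : i ≤ j)
    (hj : j < l.length) : l[i]'(hij.trans_lt hj) ≤ l[j] := by
  rcases hij.eq_or_lt with rfl | hlt
  · exact le_rfl
  · exact List.pairwise_iff_getElem.1 h i j _ hj hlt

/-- The first word is cut after `j` letters and the second after `j + 1`. The heads stay in place,
so the same cuts undo the exchange. -/
theorem swapTails_swapTails {p : List ℕ × List ℕ} {j : ℕ} (h1 : j < p.2.length)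
    (h2 : j ≤ p.1.length) : swapTails j (swapTails j p) = p := by
  have e1 : (p.1.take j).length = j := by rw [List.length_take]; omega
  have e2 : (p.2.take (j + 1)).length = j + 1 := by rw [List.length_take]; omega
  apply Prod.ext
  · change (p.1.take j ++ p.2.drop (j + 1)).take j
      ++ (p.2.take (j + 1) ++ p.1.drop j).drop (j + 1) = p.1
    rw [List.take_left' e1, List.drop_left' e2, List.take_append_drop]
  · change (p.2.take (j + 1) ++ p.1.drop j).take (j + 1)
      ++ (p.1.take j ++ p.2.drop (j + 1)).drop j = p.2
    rw [List.take_left' e2, List.drop_left' e1, List.take_append_drop]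

/-- For words `x`, `y` crossing at `j`, the first new word is sorted since `x_i < y_i` for `i < j`,
and the second since `y_j ≤ x_j`. Columns before `j` do not change, and column `j` now has `y_{j+1}`
above `y_j`, so `j` is again the first crossing. -/
theorem swapTails_mem {a b : ℕ} {c : ℕ →₀ ℕ} {p : List ℕ × List ℕ} {j : ℕ}
    (hp : p ∈ sortedPairs a b c) (hj : CrossesAt p j) :
    swapTails j p ∈ sortedPairs (b - 1) (a + 1) c ∧ CrossesAt (swapTails j p) j := by
  obtain ⟨x, y⟩ := p
  obtain ⟨⟨hx, hy⟩, ⟨rfl, rfl⟩, hc⟩ := hp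
  obtain ⟨⟨h1, h2⟩, h3, h4⟩ := hj
  dsimp only at *
  refine ⟨⟨⟨?_, ?_⟩, ⟨?_, ?_⟩, fun k => ?_⟩, ⟨?_, ?_⟩, ?_, ?_⟩
  · refine List.pairwise_append.2 ⟨hx.sublist (List.take_sublist _ _),
      hy.sublist (List.drop_sublist _ _), fun u hu v hv => ?_⟩
    obtain ⟨i, hi, rfl⟩ := List.getElem_of_mem hu
    obtain ⟨m, hm, rfl⟩ := List.getElem_of_mem hv
    simp only [List.length_take, List.length_drop] at hi hm
    rw [List.getElem_take, List.getElem_drop]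
    exact (h3 i (by omega) (by omega) (by omega)).le.trans
      (getElem_le_of_pairwise hy (by omega) _)
  · refine List.pairwise_append.2 ⟨hy.sublist (List.take_sublist _ _),
      hx.sublist (List.drop_sublist _ _), fun u hu v hv => ?_⟩
    obtain ⟨i, hi, rfl⟩ := List.getElem_of_mem hu
    obtain ⟨m, hm, rfl⟩ := List.getElem_of_mem hv
    simp only [List.length_take, List.length_drop] at hi hm
    rw [List.getElem_take, List.getElem_drop]
    exact (getElem_le_of_pairwise hy (j := j) (by omega) h1).trans
      ((h4 (by omega) h1).trans (getElem_le_of_pairwise hx (by omega) _))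
  · simp only [swapTails, List.length_append, List.length_take, List.length_drop]
    omega
  · simp only [swapTails, List.length_append, List.length_take, List.length_drop]
    omega
  · have ex := congrArg (List.count k) (List.take_append_drop j x)
    have ey := congrArg (List.count k) (List.take_append_drop (j + 1) y)
    rw [List.count_append] at ex ey
    simp only [swapTails, List.count_append]
    rw [← hc k]
    omega
  · simp only [swapTails, List.length_append, List.length_take, List.length_drop]
    omega
  · simp only [swapTails, List.length_append, List.length_take, List.length_drop]
    omega
  · intro i hi1 hi2 hij
    simp only [swapTails]
    rw [List.getElem_append_left (by rw [List.length_take]; omega),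
      List.getElem_append_left (by rw [List.length_take]; omega), List.getElem_take,
      List.getElem_take]
    exact h3 i (by omega) (by omega) hij
  · intro hj1 hj2
    simp only [swapTails, List.length_append, List.length_take, List.length_drop] at hj1
    simp only [swapTails]
    rw [List.getElem_append_left (by rw [List.length_take]; omega),
      List.getElem_append_right (by rw [List.length_take]; omega), List.getElem_take,
      List.getElem_drop]
    exact getElem_le_of_pairwise hy (by rw [List.length_take]; omega) _

/-- Exchanging tails at the first crossing preserves that crossing, so the same exchange is the
inverse map. -/
theorem card_crossing_eq {a b : ℕ} (hb : 1 ≤ b) (c : ℕ →₀ ℕ) :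
    Nat.card {p // p ∈ sortedPairs a b c ∧ ∃ j, CrossesAt p j}
      = Nat.card {p // p ∈ sortedPairs (b - 1) (a + 1) c ∧ ∃ j, CrossesAt p j} := by
  have hback : ∀ p j, p ∈ sortedPairs (b - 1) (a + 1) c → CrossesAt p j →
      swapTails j p ∈ sortedPairs a b c ∧ CrossesAt (swapTails j p) j := fun p j hp hj => by
    have := swapTails_mem hp hj
    rwa [Nat.add_sub_cancel, Nat.sub_add_cancel hb] at this
  refine Nat.card_congr (Equiv.ofBijective (fun p => ⟨swapTails p.2.2.choose p.1,
    (swapTails_mem p.2.1 p.2.2.choose_spec).1, _,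
    (swapTails_mem p.2.1 p.2.2.choose_spec).2⟩) ⟨?_, ?_⟩)
  · rintro ⟨p, hp, hpj⟩ ⟨q, hq, hqj⟩ h
    have h : swapTails hpj.choose p = swapTails hqj.choose q := congrArg Subtype.val h
    have h1 := hpj.choose_spec
    have h2 := hqj.choose_spec
    have e : hpj.choose = hqj.choose :=
      (h ▸ (swapTails_mem hp h1).2).unique (swapTails_mem hq h2).2
    apply Subtype.ext
    change p = q
    rw [← swapTails_swapTails h1.1.1 h1.1.2, h, ← e, e, swapTails_swapTails h2.1.1 h2.1.2]
  · rintro ⟨p, hp, j, hj⟩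
    obtain ⟨h1, h2⟩ := hback p j hp hj
    refine ⟨⟨swapTails j p, h1, j, h2⟩, Subtype.ext ?_⟩
    have hex : ∃ j', CrossesAt (swapTails j p) j' := ⟨j, h2⟩
    change swapTails hex.choose (swapTails j p) = p
    rw [hex.choose_spec.unique h2, swapTails_swapTails hj.1.1 hj.1.2]

/-- A weakly increasing word is determined by its content. -/
theorem nonempty_sortedPairs_equiv (a b : ℕ) (c : ℕ →₀ ℕ) :
    Nonempty (sortedPairs a b c ≃ contentSplittings a b c) := by
  classical
  have hdeg : ∀ l : List ℕ, (Multiset.toFinsupp (l : Multiset ℕ)).degree = l.length := fun l => by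
    have := Multiset.toFinsupp_sum_eq (l : Multiset ℕ)
    rw [Finsupp.degree_apply]
    exact this
  refine ⟨Equiv.ofBijective (fun p => ⟨(Multiset.toFinsupp (p.1.1 : Multiset ℕ),
    Multiset.toFinsupp (p.1.2 : Multiset ℕ)), ?_⟩) ⟨?_, ?_⟩⟩
  · obtain ⟨p, -, ⟨h1, h2⟩, h3⟩ := p
    rw [contentSplittings, Finset.mem_filter, Finset.HasAntidiagonal.mem_antidiagonal, hdeg, hdeg]
    refine ⟨?_, h1, h2⟩
    ext k
    simpa using h3 k
  · rintro ⟨p, hp⟩ ⟨q, hq⟩ h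
    have h := congrArg Subtype.val h
    have h1 : (p.1 : Multiset ℕ) = q.1 := Multiset.toFinsupp.injective (congrArg Prod.fst h)
    have h2 : (p.2 : Multiset ℕ) = q.2 := Multiset.toFinsupp.injective (congrArg Prod.snd h)
    exact Subtype.ext (Prod.ext ((Multiset.coe_eq_coe.1 h1).eq_of_pairwise
        (fun _ _ _ _ => le_antisymm) hp.1.1 hq.1.1)
      ((Multiset.coe_eq_coe.1 h2).eq_of_pairwise (fun _ _ _ _ => le_antisymm) hp.1.2 hq.1.2))
  · rintro ⟨⟨c1, c2⟩, h⟩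
    rw [contentSplittings, Finset.mem_filter, Finset.HasAntidiagonal.mem_antidiagonal] at h
    obtain ⟨h, h1, h2⟩ := h
    have e : ∀ c : ℕ →₀ ℕ, Multiset.toFinsupp
        (((Finsupp.toMultiset c).sort (· ≤ ·) : List ℕ) : Multiset ℕ) = c := fun c => by
      rw [Multiset.sort_eq, Finsupp.toMultiset_toFinsupp]
    refine ⟨⟨((Finsupp.toMultiset c1).sort (· ≤ ·), (Finsupp.toMultiset c2).sort (· ≤ ·)),
      ⟨Multiset.pairwise_sort _ _, Multiset.pairwise_sort _ _⟩, ⟨?_, ?_⟩, fun k => ?_⟩,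
      Subtype.ext (Prod.ext (e c1) (e c2))⟩
    · rw [← hdeg, e, h1]
    · rw [← hdeg, e, h2]
    · rw [← h, Finsupp.add_apply, ← Multiset.coe_count, ← Multiset.coe_count, Multiset.sort_eq,
        Multiset.sort_eq, Finsupp.count_toMultiset, Finsupp.count_toMultiset]

theorem card_sortedPairs (a b : ℕ) (c : ℕ →₀ ℕ) :
    Nat.card (sortedPairs a b c) = (contentSplittings a b c).card := by
  rw [← Nat.card_eq_finsetCard]
  exact Nat.card_congr (nonempty_sortedPairs_equiv a b c).some

theorem finite_sortedPairs (a b : ℕ) (c : ℕ →₀ ℕ) : (sortedPairs a b c).Finite :=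
  Set.finite_coe_iff.1 (Finite.of_equiv _ (nonempty_sortedPairs_equiv a b c).some.symm)

/-- Within lengths `(a, b)` the crossing pairs are the complement of the column-strict ones. Within
lengths `(b - 1, a + 1)` the second word is longer, so every pair crosses. The tail exchange matches
the two crossing families. -/
theorem card_columnStrict_add {a b : ℕ} (hb : 1 ≤ b) (hab : b ≤ a) (c : ℕ →₀ ℕ) :
    Nat.card {p // p ∈ sortedPairs a b c ∧ ColumnStrict p}
      + (contentSplittings (b - 1) (a + 1) c).card = (contentSplittings a b c).card := by
  classical
  have hfin := finite_sortedPairs a b c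
  have e1 : Nat.card {p // p ∈ sortedPairs (b - 1) (a + 1) c ∧ ∃ j, CrossesAt p j}
      = (contentSplittings (b - 1) (a + 1) c).card := by
    rw [← card_sortedPairs]
    refine Nat.card_congr (Equiv.subtypeEquivRight fun p => ⟨fun h => h.1, fun h => ⟨h, ?_⟩⟩)
    apply exists_crossesAt
    right
    rw [h.2.1.1, h.2.1.2]
    omega
  have e2 : {p | p ∈ sortedPairs a b c ∧ ∃ j, CrossesAt p j}
      = sortedPairs a b c \ {p | p ∈ sortedPairs a b c ∧ ColumnStrict p} := by
    ext p
    constructor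
    · rintro ⟨hp, j, hj⟩
      exact ⟨hp, fun h => hj.not_columnStrict (by rw [hp.2.1.1, hp.2.1.2]; exact hab) h.2⟩
    · rintro ⟨hp, h⟩
      exact ⟨hp, exists_crossesAt (Or.inl fun hc => h ⟨hp, hc⟩)⟩
  rw [← e1, ← card_crossing_eq hb, ← card_sortedPairs]
  have h := Set.ncard_sdiff_add_ncard_of_subset (s := {p | p ∈ sortedPairs a b c ∧ ColumnStrict p})
    (t := sortedPairs a b c) (fun p hp => hp.1) hfin
  rw [← e2] at h
  rw [add_comm]
  exact h

/-- A tableau is the pair of its rows. The shape is given by its cells so that the shapes `[a, b]`,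
`[a]` and `[k, 0]` are treated alike. -/
theorem numTableaux_eq_card_columnStrict {μ : YoungDiagram} {a b : ℕ} (hab : b ≤ a)
    (hμ : ∀ i j, (i, j) ∈ μ ↔ (i = 0 ∧ j < a) ∨ (i = 1 ∧ j < b)) (c : ℕ →₀ ℕ) :
    numTableaux μ c = Nat.card {p // p ∈ sortedPairs a b c ∧ ColumnStrict p} := by
  classical
  have hcount : ∀ (f : ℕ → ℕ) (m k : ℕ),
      ((List.range m).map f).count k = ((Finset.range m).filter fun j => f j = k).card := by
    intro f m k
    induction m with
    | zero => rfl
    | succ m ih =>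
      rw [List.range_succ, List.map_append, List.count_append, ih, Finset.range_add_one,
        Finset.filter_insert]
      by_cases h : f m = k <;> simp [h]
  have hcells : ∀ (T : ℕ → ℕ → ℕ) (k : ℕ), (μ.cells.filter fun x => T x.1 x.2 = k).card
      = ((Finset.range a).filter fun j => T 0 j = k).card
        + ((Finset.range b).filter fun j => T 1 j = k).card := by
    intro T k
    have : (μ.cells.filter fun x => T x.1 x.2 = k)
        = (((Finset.range a).filter fun j => T 0 j = k).image (Prod.mk 0))
          ∪ (((Finset.range b).filter fun j => T 1 j = k).image (Prod.mk 1)) := by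
      ext ⟨i, j⟩
      simp only [Finset.mem_filter, YoungDiagram.mem_cells, hμ, Finset.mem_union, Finset.mem_image,
        Finset.mem_range, Prod.mk.injEq]
      constructor
      · rintro ⟨⟨rfl, h⟩ | ⟨rfl, h⟩, h'⟩
        · exact Or.inl ⟨j, ⟨h, h'⟩, rfl, rfl⟩
        · exact Or.inr ⟨j, ⟨h, h'⟩, rfl, rfl⟩
      · rintro (⟨j', ⟨h, h'⟩, rfl, rfl⟩ | ⟨j', ⟨h, h'⟩, rfl, rfl⟩)
        · exact ⟨Or.inl ⟨rfl, h⟩, h'⟩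
        · exact ⟨Or.inr ⟨rfl, h⟩, h'⟩
    rw [this, Finset.card_union_of_disjoint, Finset.card_image_of_injective _
      (Prod.mk_right_injective _), Finset.card_image_of_injective _ (Prod.mk_right_injective _)]
    rw [Finset.disjoint_left]
    rintro ⟨i, j⟩ h1 h2
    simp only [Finset.mem_image, Prod.mk.injEq] at h1 h2
    obtain ⟨_, _, rfl, _⟩ := h1
    obtain ⟨_, _, h, _⟩ := h2
    exact one_ne_zero h
  have hpair : ∀ (f : ℕ → ℕ) (m : ℕ), (∀ i j, i < j → j < m → f i ≤ f j) →
      ((List.range m).map f).Pairwise (· ≤ ·) := by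
    intro f m h
    rw [List.pairwise_iff_getElem]
    intro i j hi hj hij
    simp only [List.getElem_map, List.getElem_range]
    exact h i j hij (by simpa using hj)
  refine Nat.card_congr (Equiv.ofBijective (fun T =>
    ⟨((List.range a).map (T.1 0), (List.range b).map (T.1 1)), ⟨⟨?_, ?_⟩, ⟨?_, ?_⟩, ?_⟩, ?_⟩)
    ⟨?_, ?_⟩)
  · exact hpair _ _ fun i j hij hj => T.1.row_weak hij ((hμ _ _).2 (Or.inl ⟨rfl, hj⟩))
  · exact hpair _ _ fun i j hij hj => T.1.row_weak hij ((hμ _ _).2 (Or.inr ⟨rfl, hj⟩))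
  · simp
  · simp
  · intro k
    rw [hcount, hcount, ← T.2 k, hcells]
  · intro i h1 h2
    simp only [List.getElem_map, List.getElem_range]
    exact T.1.col_strict one_pos ((hμ _ _).2 (Or.inr ⟨rfl, by simpa using h2⟩))
  · rintro ⟨T, hT⟩ ⟨T', hT'⟩ h
    have h := congrArg Subtype.val h
    have h1 : ∀ j < a, T 0 j = T' 0 j := by
      simpa using congrArg Prod.fst h
    have h2 : ∀ j < b, T 1 j = T' 1 j := by
      simpa using congrArg Prod.snd h
    refine Subtype.ext (SemistandardYoungTableau.ext fun i j => ?_)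
    by_cases hm : (i, j) ∈ μ
    · rcases (hμ i j).1 hm with ⟨rfl, hj⟩ | ⟨rfl, hj⟩
      · exact h1 j hj
      · exact h2 j hj
    · rw [T.zeros hm, T'.zeros hm]
  · rintro ⟨⟨x, y⟩, ⟨⟨hx, hy⟩, ⟨rfl, rfl⟩, hc⟩, hs⟩
    dsimp only at *
    have hxm : (List.range x.length).map (fun j => x.getD j 0) = x := by
      apply List.ext_getElem <;> simp +contextual
    have hym : (List.range y.length).map (fun j => y.getD j 0) = y := by
      apply List.ext_getElem <;> simp +contextual
    have hget : ∀ (l : List ℕ) (i : ℕ) (h : i < l.length), l.getD i 0 = l[i] := fun l i h =>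
      List.getD_eq_getElem _ _ h
    -- The default `0` of `getD` agrees with the convention that a tableau vanishes outside its
    -- shape.
    let T : SemistandardYoungTableau μ :=
      { entry := fun i j => if i = 0 then x.getD j 0 else if i = 1 then y.getD j 0 else 0
        row_weak' := by
          intro i j1 j2 hj hm
          rcases (hμ _ _).1 hm with ⟨rfl, hj2⟩ | ⟨rfl, hj2⟩
          · simp only [if_true]
            rw [hget x _ hj2, hget x _ (hj.trans hj2)]
            exact getElem_le_of_pairwise hx hj.le _
          · simp only [one_ne_zero, if_false, if_true]
            rw [hget y _ hj2, hget y _ (hj.trans hj2)]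
            exact getElem_le_of_pairwise hy hj.le _
        col_strict' := by
          intro i1 i2 j hi hm
          rcases (hμ _ _).1 hm with ⟨rfl, hj2⟩ | ⟨rfl, hj2⟩
          · omega
          · obtain rfl : i1 = 0 := by omega
            simp only [one_ne_zero, if_false, if_true]
            rw [hget y _ hj2, hget x _ (hj2.trans_le hab)]
            exact hs j _ _
        zeros' := by
          intro i j hm
          rw [hμ, not_or] at hm
          by_cases h0 : i = 0
          · rw [if_pos h0, List.getD_eq_default]
            have := hm.1
            simpa [h0] using this
          · rw [if_neg h0]
            by_cases h1 : i = 1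
            · rw [if_pos h1, List.getD_eq_default]
              have := hm.2
              simpa [h1] using this
            · rw [if_neg h1] }
    have hT0 : T 0 = fun j => x.getD j 0 := rfl
    have hT1 : T 1 = fun j => y.getD j 0 := rfl
    refine ⟨⟨T, fun k => ?_⟩, Subtype.ext (Prod.ext ?_ ?_)⟩
    · rw [hcells, ← hcount, ← hcount, hT0, hT1, hxm, hym, hc]
    · change (List.range x.length).map (T 0) = x
      rw [hT0, hxm]
    · change (List.range y.length).map (T 1) = y
      rw [hT1, hym]

theorem mem_ofRowLens_pair {a b : ℕ} (h : [a, b].SortedGE) (i j : ℕ) :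
    (i, j) ∈ YoungDiagram.ofRowLens [a, b] h ↔ (i = 0 ∧ j < a) ∨ (i = 1 ∧ j < b) := by
  rw [YoungDiagram.mem_ofRowLens]
  rcases i with _ | _ | i <;> simp

theorem mem_ofRowLens_singleton {a : ℕ} (h : [a].SortedGE) (i j : ℕ) :
    (i, j) ∈ YoungDiagram.ofRowLens [a] h ↔ (i = 0 ∧ j < a) ∨ (i = 1 ∧ j < 0) := by
  rw [YoungDiagram.mem_ofRowLens]
  rcases i with _ | i <;> simp

theorem sortedGE_pair {a b : ℕ} (h : b ≤ a) : [a, b].SortedGE := by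
  rw [List.sortedGE_iff_pairwise]
  simpa using h

theorem numTableaux_one_row {μ : YoungDiagram} {a : ℕ}
    (hμ : ∀ i j, (i, j) ∈ μ ↔ (i = 0 ∧ j < a) ∨ (i = 1 ∧ j < 0)) (c : ℕ →₀ ℕ) :
    numTableaux μ c = if c.degree = a then 1 else 0 := by
  classical
  rw [numTableaux_eq_card_columnStrict (Nat.zero_le a) hμ]
  have : Nat.card {p // p ∈ sortedPairs a 0 c ∧ ColumnStrict p} = Nat.card (sortedPairs a 0 c) := by
    refine Nat.card_congr (Equiv.subtypeEquivRight fun p => ⟨fun h => h.1, fun h => ⟨h, ?_⟩⟩)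
    intro i _ h2
    rw [h.2.1.2] at h2
    omega
  rw [this, card_sortedPairs]
  have hz : ∀ p ∈ contentSplittings a 0 c, p = (c, 0) ∧ c.degree = a := by
    rintro ⟨c1, c2⟩ hp
    rw [contentSplittings, Finset.mem_filter, Finset.HasAntidiagonal.mem_antidiagonal] at hp
    obtain ⟨h, h1, h2⟩ := hp
    have h2 : c2 = 0 := (Finsupp.degree_eq_zero_iff c2).1 h2
    dsimp only at h h1
    rw [h2, add_zero] at h
    exact ⟨by rw [h, h2], h ▸ h1⟩
  split_ifs with hc
  · rw [Finset.card_eq_one]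
    refine ⟨(c, 0), Finset.eq_singleton_iff_unique_mem.2 ⟨?_, fun p hp => (hz p hp).1⟩⟩
    rw [contentSplittings, Finset.mem_filter, Finset.HasAntidiagonal.mem_antidiagonal]
    exact ⟨add_zero c, hc, map_zero _⟩
  · rw [Finset.card_eq_zero, Finset.eq_empty_iff_forall_notMem]
    exact fun p hp => hc (hz p hp).2

theorem schur_singleton {ι : Type*} (A : Type*) [CommSemiring A] (e : ι ↪ ℕ) (k : ℕ) :
    schur A e [k] = completeHomog ι A k := by
  have h : [k].SortedGE := by simp [List.sortedGE_iff_pairwise]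
  rw [schur, dif_pos h]
  funext c
  rw [schurDiagram, numTableaux_one_row (mem_ofRowLens_singleton h), degree_embDomain,
    completeHomog]
  split_ifs <;> simp

theorem schur_pair_zero {ι : Type*} (A : Type*) [CommSemiring A] (e : ι ↪ ℕ) (k : ℕ) :
    schur A e [k, 0] = completeHomog ι A k := by
  have h : [k, 0].SortedGE := sortedGE_pair (Nat.zero_le k)
  rw [schur, dif_pos h]
  funext c
  rw [schurDiagram, numTableaux_one_row (mem_ofRowLens_pair h), degree_embDomain,
    completeHomog]
  split_ifs <;> simp

/-- The Jacobi–Trudi identity for two rows. -/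
theorem schur_pair_add (A : Type*) [CommSemiring A] {a b : ℕ} (hb : 1 ≤ b) (hab : b ≤ a) :
    schur A (Function.Embedding.refl ℕ) [a, b]
      + completeHomog ℕ A (a + 1) * completeHomog ℕ A (b - 1)
        = completeHomog ℕ A a * completeHomog ℕ A b := by
  have h : [a, b].SortedGE := sortedGE_pair hab
  ext c
  rw [map_add, mul_comm, coeff_completeHomog_mul, coeff_completeHomog_mul,
    ← card_columnStrict_add hb hab, ← numTableaux_eq_card_columnStrict hab (mem_ofRowLens_pair h),
    schur, dif_pos h, Nat.cast_add]
  congr 1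
  change ((numTableaux _ (c.embDomain (Function.Embedding.refl ℕ)) : ℕ) : A) = _
  rw [Finsupp.embDomain_refl, id]

theorem completeHomog_zero (ι A : Type*) [CommSemiring A] : completeHomog ι A 0 = 1 := by
  classical
  ext c
  rw [MvPowerSeries.coeff_one]
  change (if c.degree = 0 then (1 : A) else 0) = _
  simp [Finsupp.degree_eq_zero_iff]

theorem sQ_eq_hQ (K : Type*) [Field K] (ℓ k : ℕ) : sQ K ℓ k = hQ K ℓ k :=
  schur_singleton _ _ _

theorem sW_singleton (K : Type*) [Field K] (ℓ k : ℕ) : sW K ℓ [k] = hW K ℓ k := by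
  rw [sW, schur_singleton, hW]

theorem sW_pair_zero (K : Type*) [Field K] (ℓ k : ℕ) : sW K ℓ [k, 0] = hW K ℓ k := by
  rw [sW, schur_pair_zero, hW]

theorem hW_zero (K : Type*) [Field K] (ℓ : ℕ) : hW K ℓ 0 = 1 := by
  rw [hW, completeHomog_zero, map_one]

theorem sW_pair_add (K : Type*) [Field K] (ℓ : ℕ) {a b : ℕ} (hb : 1 ≤ b) (hab : b ≤ a) :
    sW K ℓ [a, b] + hW K ℓ (a + 1) * hW K ℓ (b - 1) = hW K ℓ a * hW K ℓ b := by
  simp only [sW, hW, ← map_mul, ← map_add, schur_pair_add K hb hab]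

end TwoRowSchur

/-! ### Operators on monomials, and the module generated by a power of `p₁` -/

section LinearPowerSums

open MvPolynomial

variable {K : Type*} [Field K] {ℓ n : ℕ}

theorem polarizationOp_apply (i k : Fin ℓ) (p : ℕ) (g : Poly K ℓ n) :
    polarizationOp i k p g = ∑ j, X (i, j) * (partialDeriv k j ^ p) g := by
  simp [polarizationOp]

theorem diagRep_apply (σ : Equiv.Perm (Fin n)) (g : Poly K ℓ n) :
    diagRep K ℓ n σ g = rename (fun x : Fin ℓ × Fin n => (x.1, σ x.2)) g := rfl

theorem isWeightedHomogeneous_X (x : Fin ℓ × Fin n) :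
    IsWeightedHomogeneous rowWeight (X x : Poly K ℓ n) (Finsupp.single x.1 1) :=
  MvPolynomial.isWeightedHomogeneous_X K rowWeight x

theorem sum_smul_single {ι : Type*} [Fintype ι] (δ : ι →₀ ℕ) :
    ∑ i, δ i • Finsupp.single i 1 = δ := by
  classical
  ext i
  simp

/-! ### Monomials in one set of variables -/

theorem pderiv_pow_monomial {ι : Type*} (k : ι) (p : ℕ) (α : ι →₀ ℕ) :
    ((pderiv (R := K) k).toLinearMap ^ p) (monomial α 1)
      = monomial (α - Finsupp.single k p) ((α k).descFactorial p : K) := by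
  induction p with
  | zero => simp
  | succ p ih =>
    rw [pow_succ', Module.End.mul_apply, ih]
    change pderiv k _ = _
    rw [pderiv_monomial, tsub_tsub, ← Finsupp.single_add, Nat.descFactorial_succ,
      Finsupp.tsub_apply, Finsupp.single_eq_same, ← Nat.cast_mul, mul_comm]

theorem degree_sub_single {ι : Type*} {α : ι →₀ ℕ} {k : ι} {p : ℕ} (h : p ≤ α k) :
    (α - Finsupp.single k p).degree + p = α.degree := by
  conv_rhs => rw [← tsub_add_cancel_of_le (Finsupp.single_le_iff.2 h)]
  rw [map_add, Finsupp.degree_single]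

/-- The operator `x_i ∂_k^p` changes the degree by `1 - p`. For `p ≥ 1` it never raises it, which is
why bounds on the degree describe closed subspaces. -/
theorem X_mul_pderiv_pow_monomial {ι : Type*} (i k : ι) (p : ℕ) (α : ι →₀ ℕ) :
    X i * ((pderiv (R := K) k).toLinearMap ^ p) (monomial α 1) = 0 ∨
      ∃ (c : K) (β : ι →₀ ℕ), X i * ((pderiv (R := K) k).toLinearMap ^ p) (monomial α 1)
        = c • monomial β 1 ∧ β.degree + p = α.degree + 1 := by
  rw [pderiv_pow_monomial]
  by_cases h : p ≤ α k
  · right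
    refine ⟨(α k).descFactorial p, Finsupp.single i 1 + (α - Finsupp.single k p), ?_, ?_⟩
    · rw [X, monomial_mul, smul_monomial, one_mul, smul_eq_mul, mul_one]
    · have := degree_sub_single h
      rw [map_add, Finsupp.degree_single]
      omega
  · left
    rw [Nat.descFactorial_of_lt (not_le.1 h)]
    simp

theorem pderiv_monomial_eq_zero_or {ι : Type*} (k : ι) (α : ι →₀ ℕ) :
    pderiv (R := K) k (monomial α 1) = 0 ∨
      ∃ (c : K) (β : ι →₀ ℕ), pderiv (R := K) k (monomial α 1) = c • monomial β 1 ∧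
        β.degree + 1 = α.degree := by
  rw [pderiv_monomial]
  by_cases h : 1 ≤ α k
  · right
    refine ⟨α k, α - Finsupp.single k 1, ?_, degree_sub_single h⟩
    rw [smul_monomial, one_mul, smul_eq_mul, mul_one]
  · left
    rw [show α k = 0 by omega]
    simp

theorem pderiv_monomial_add_single {ι : Type*} (k : ι) (β : ι →₀ ℕ) :
    pderiv (R := K) k (monomial (β + Finsupp.single k 1) 1)
      = ((β k + 1 : ℕ) : K) • monomial β 1 := by
  rw [pderiv_monomial, add_tsub_cancel_right, Finsupp.add_apply, Finsupp.single_eq_same,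
    smul_monomial, one_mul, smul_eq_mul, mul_one]

/-- Moves one unit of exponent from `k` to `i` with a factor that is nonzero in characteristic zero,
as needed for `degree_eq_induction`. -/
theorem X_mul_pderiv_monomial_add_single {ι : Type*} (i k : ι) (β : ι →₀ ℕ) :
    X i * ((pderiv (R := K) k).toLinearMap ^ 1) (monomial (β + Finsupp.single k 1) 1)
      = ((β k + 1 : ℕ) : K) • monomial (β + Finsupp.single i 1) 1 := by
  rw [pow_one]
  change X i * pderiv k _ = _
  rw [pderiv_monomial_add_single, mul_smul_comm, X, monomial_mul, one_mul,
    add_comm (Finsupp.single i 1)]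

/-! ### The module generated by a power of `p₁` -/

/-- Substitution of the linear power sums `∑_j x_{ij}`. -/
def linSubst (K : Type*) [Field K] (ℓ n : ℕ) : MvPolynomial (Fin ℓ) K →ₐ[K] Poly K ℓ n :=
  aeval fun i => ∑ j, X (i, j)

theorem linSubst_X (i : Fin ℓ) : linSubst K ℓ n (X i) = ∑ j, X (i, j) := aeval_X _ _

theorem diagRep_linSubst (σ : Equiv.Perm (Fin n)) (f : MvPolynomial (Fin ℓ) K) :
    diagRep K ℓ n σ (linSubst K ℓ n f) = linSubst K ℓ n f := by
  rw [diagRep_apply]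
  refine DFunLike.congr_fun (f := (rename fun x : Fin ℓ × Fin n => (x.1, σ x.2)).comp
    (linSubst K ℓ n)) (algHom_ext fun i => ?_) f
  rw [AlgHom.comp_apply, linSubst_X, map_sum]
  simp only [rename_X]
  exact Equiv.sum_comp σ fun j => (X (i, j) : Poly K ℓ n)

/-- Chain rule: the derivative of a row sum by `x_{ij}` is `0` or `1` and does not depend on `j`. -/
theorem partialDeriv_linSubst (i : Fin ℓ) (j : Fin n) (f : MvPolynomial (Fin ℓ) K) :
    partialDeriv i j (linSubst K ℓ n f) = linSubst K ℓ n (pderiv i f) := by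
  change pderiv (i, j) _ = _
  induction f using MvPolynomial.induction_on with
  | C a => simp [linSubst]
  | add f g hf hg => rw [map_add, map_add, hf, hg, map_add, map_add]
  | mul_X f k hf =>
    have hX : pderiv (i, j) (∑ j', X (k, j') : Poly K ℓ n)
        = linSubst K ℓ n (pderiv i (X k)) := by
      classical
      rw [map_sum]
      simp only [pderiv_X, Pi.single_apply, Prod.mk.injEq]
      by_cases hk : k = i <;> simp [hk]
    rw [map_mul, pderiv_mul, hf, pderiv_mul, linSubst_X, hX, map_add, map_mul, map_mul, linSubst_X]

theorem partialDeriv_pow_linSubst (i : Fin ℓ) (j : Fin n) (p : ℕ) (f : MvPolynomial (Fin ℓ) K) :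
    (partialDeriv i j ^ p) (linSubst K ℓ n f)
      = linSubst K ℓ n (((pderiv (R := K) i).toLinearMap ^ p) f) := by
  induction p with
  | zero => rfl
  | succ p ih =>
    rw [pow_succ', Module.End.mul_apply, ih, partialDeriv_linSubst, pow_succ',
      Module.End.mul_apply]
    rfl

theorem polarizationOp_linSubst (i k : Fin ℓ) (p : ℕ) (f : MvPolynomial (Fin ℓ) K) :
    polarizationOp i k p (linSubst K ℓ n f)
      = linSubst K ℓ n (X i * ((pderiv (R := K) k).toLinearMap ^ p) f) := by
  rw [polarizationOp_apply, map_mul, linSubst_X, Finset.sum_mul]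
  exact Finset.sum_congr rfl fun j _ => by rw [partialDeriv_pow_linSubst]

theorem isWeightedHomogeneous_linSubst (α : Fin ℓ →₀ ℕ) :
    IsWeightedHomogeneous rowWeight (linSubst K ℓ n (monomial α 1)) α := by
  rw [linSubst, aeval_monomial, map_one, one_mul, Finsupp.prod_fintype _ _ (by simp)]
  have h := IsWeightedHomogeneous.prod (w := rowWeight (ℓ := ℓ) (n := n)) Finset.univ
    (fun i => (∑ j, X (i, j) : Poly K ℓ n) ^ α i) (fun i => α i • Finsupp.single i 1)
    (fun i _ => IsWeightedHomogeneous.pow ?_ _)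
  · rwa [sum_smul_single] at h
  · exact IsWeightedHomogeneous.sum _ _ _ fun j _ => isWeightedHomogeneous_X (i, j)

/-- A product of nonzero linear forms in a domain; `1 ≤ n` makes the row sums nonzero. -/
theorem linSubst_monomial_ne_zero (hn : 1 ≤ n) (α : Fin ℓ →₀ ℕ) :
    linSubst K ℓ n (monomial α 1) ≠ 0 := by
  classical
  rw [linSubst, aeval_monomial, map_one, one_mul, Finsupp.prod_fintype _ _ (by simp)]
  refine Finset.prod_ne_zero_iff.2 fun i _ => pow_ne_zero _ fun h => ?_
  have := congrArg (coeff (Finsupp.single (i, (⟨0, hn⟩ : Fin n)) 1)) h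
  simp [coeff_sum, coeff_X, Finsupp.single_left_inj] at this

theorem polarizationModuleOf_psum_one_pow [CharZero K] (i₀ : Fin ℓ) (hn : 1 ≤ n) (d : ℕ) :
    (polarizationModuleOf (inRow i₀ (psum (Fin n) K 1 ^ d))).toSubmodule
      = Submodule.span K (Set.range fun α : {α : Fin ℓ →₀ ℕ // α.degree ≤ d} =>
          linSubst K ℓ n (monomial α.1 1)) := by
  have hf : inRow i₀ (psum (Fin n) K 1 ^ d) = linSubst K ℓ n (monomial (Finsupp.single i₀ d) 1) := by
    rw [← X_pow_eq_monomial, map_pow, linSubst_X, inRow, map_pow]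
    simp [psum]
  have hmem : ∀ (c : K) (β : Fin ℓ →₀ ℕ), β.degree ≤ d → linSubst K ℓ n (c • monomial β 1) ∈
      Submodule.span K (Set.range fun α : {α : Fin ℓ →₀ ℕ // α.degree ≤ d} =>
          linSubst K ℓ n (monomial α.1 1)) := fun c β hβ => by
    rw [map_smul]
    exact Submodule.smul_mem _ _ (Submodule.subset_span ⟨⟨β, hβ⟩, rfl⟩)
  rw [hf]
  refine polarizationModuleOf_toSubmodule_eq_span _ (fun σ => diagRep_linSubst σ _) _ ?_ ?_ ?_ ?_
  · exact Submodule.subset_span ⟨⟨_, (Finsupp.degree_single _ _).le⟩, rfl⟩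
  · rintro i j _ ⟨⟨α, hα⟩, rfl⟩
    rw [partialDeriv_linSubst]
    rcases pderiv_monomial_eq_zero_or (K := K) i α with h | ⟨c, β, h, hβ⟩
    · rw [h, map_zero]
      exact Submodule.zero_mem _
    · rw [h]
      exact hmem _ _ (by omega)
  · rintro i k p hp _ ⟨⟨α, hα⟩, rfl⟩
    rw [polarizationOp_linSubst]
    rcases X_mul_pderiv_pow_monomial (K := K) i k p α with h | ⟨c, β, h, hβ⟩
    · rw [h, map_zero]
      exact Submodule.zero_mem _
    · rw [h]
      exact hmem _ _ (by omega)
  · intro V hfV hVd hVp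
    have htop : ∀ α : Fin ℓ →₀ ℕ, α.degree = d → linSubst K ℓ n (monomial α 1) ∈ V := by
      refine degree_eq_induction i₀ d hfV fun β i hβ => ?_
      have := hVp i i₀ 1 le_rfl _ hβ
      rw [polarizationOp_linSubst, X_mul_pderiv_monomial_add_single, map_smul] at this
      exact (Submodule.smul_mem_iff _ (Nat.cast_ne_zero.2 (Nat.succ_ne_zero _))).1 this
    rintro _ ⟨⟨α, hα⟩, rfl⟩
    dsimp only
    -- Descending induction on the degree: raise the exponent at `i₀`, then differentiate.
    induction hm : d - α.degree generalizing α with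
    | zero => exact htop α (by omega)
    | succ m ih =>
      have hdeg : (α + Finsupp.single i₀ 1).degree = α.degree + 1 := by
        rw [map_add, Finsupp.degree_single]
      have := hVd i₀ ⟨0, hn⟩ _ (ih (α + Finsupp.single i₀ 1) (by omega) (by omega))
      rw [partialDeriv_linSubst, pderiv_monomial_add_single, map_smul] at this
      exact (Submodule.smul_mem_iff _ (Nat.cast_ne_zero.2 (Nat.succ_ne_zero _))).1 this

theorem coeff_frobeniusChar_psum_one_pow [CharZero K] (i₀ : Fin ℓ) (hn : 1 ≤ n) (d : ℕ)
    (δ : Fin ℓ →₀ ℕ) :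
    MvPowerSeries.coeff δ (frobeniusChar (polarizationModuleOf (inRow i₀ (psum (Fin n) K 1 ^ d))))
      = if δ.degree ≤ d then completeHomog ℕ K n else 0 := by
  have hcomp := component_toSubmodule_of_span _ (fun α : {α : Fin ℓ →₀ ℕ // α.degree ≤ d} => α.1)
    (fun α => isWeightedHomogeneous_linSubst α.1) _ 
    (polarizationModuleOf_psum_one_pow (K := K) i₀ hn d) δ
  split_ifs with h
  -- The only `0`-subset is `∅`, so a constant family is a one-vector basis.
  · rw [coeff_frobeniusChar_of_basis (Nat.zero_le n) _ δ
      (fun _ => linSubst K ℓ n (monomial δ 1)), completeHomog_zero, mul_one, Nat.sub_zero]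
    · have : Unique {S : Finset (Fin n) // S.card = 0} :=
        ⟨⟨⟨∅, rfl⟩⟩, fun S => Subtype.ext (Finset.card_eq_zero.1 S.2)⟩
      exact LinearIndependent.of_subsingleton default (linSubst_monomial_ne_zero hn δ)
    · rw [hcomp]
      congr 1
      ext x
      simp only [Set.mem_image, Set.mem_ofPred_eq, Subtype.exists]
      constructor
      · rintro ⟨α, hα, rfl, rfl⟩
        exact ⟨∅, rfl, rfl⟩
      · rintro ⟨S, -, rfl⟩
        exact ⟨δ, h, rfl, rfl⟩
    · exact fun σ S _ => diagRep_linSubst σ _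
  · refine coeff_frobeniusChar_of_bot _ _ ?_
    rw [hcomp, show {α : {α : Fin ℓ →₀ ℕ // α.degree ≤ d} | α.1 = δ} = ∅ from ?_,
      Set.image_empty, Submodule.span_empty]
    rw [Set.eq_empty_iff_forall_notMem]
    rintro ⟨α, hα⟩ rfl
    exact h hα

end LinearPowerSums

section PowerSums

open MvPolynomial

variable {K : Type*} [Field K] {ℓ n : ℕ}

/-! ### The module generated by a power sum -/

/-- Substitution of the variables of the `j`-th column. -/
def colSubst (K : Type*) [Field K] (ℓ : ℕ) {n : ℕ} (j : Fin n) :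
    MvPolynomial (Fin ℓ) K →ₐ[K] Poly K ℓ n :=
  rename fun i => (i, j)

theorem colSubst_X (j : Fin n) (i : Fin ℓ) : colSubst K ℓ j (X i) = X (i, j) := rename_X _ _

theorem diagRep_colSubst (σ : Equiv.Perm (Fin n)) (j : Fin n) (f : MvPolynomial (Fin ℓ) K) :
    diagRep K ℓ n σ (colSubst K ℓ j f) = colSubst K ℓ (σ j) f := by
  rw [diagRep_apply, colSubst, rename_rename]
  rfl

theorem partialDeriv_colSubst (i : Fin ℓ) (j j' : Fin n) (f : MvPolynomial (Fin ℓ) K) :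
    partialDeriv i j' (colSubst K ℓ j f) = if j = j' then colSubst K ℓ j (pderiv i f) else 0 := by
  classical
  have hinj : Function.Injective fun i : Fin ℓ => (i, j) := fun a b h => congrArg Prod.fst h
  change pderiv (i, j') (rename _ f) = _
  split_ifs with h
  · subst h
    exact pderiv_rename hinj (x := i) (p := f)
  · refine pderiv_eq_zero_of_notMem_vars fun hmem => h ?_
    obtain ⟨k, -, hk⟩ := Finset.mem_image.1 (vars_rename _ f hmem)
    exact congrArg Prod.snd hk

theorem partialDeriv_pow_colSubst (i : Fin ℓ) (j : Fin n) (p : ℕ) (f : MvPolynomial (Fin ℓ) K) :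
    (partialDeriv i j ^ p) (colSubst K ℓ j f)
      = colSubst K ℓ j (((pderiv (R := K) i).toLinearMap ^ p) f) := by
  induction p with
  | zero => rfl
  | succ p ih =>
    rw [pow_succ', Module.End.mul_apply, ih, partialDeriv_colSubst, if_pos rfl, pow_succ',
      Module.End.mul_apply]
    rfl

/-- With `p ≥ 1`, every summand that differentiates in another column vanishes. -/
theorem polarizationOp_colSubst (i k : Fin ℓ) {p : ℕ} (hp : 1 ≤ p) (j : Fin n)
    (f : MvPolynomial (Fin ℓ) K) :
    polarizationOp i k p (colSubst K ℓ j f)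
      = colSubst K ℓ j (X i * ((pderiv (R := K) k).toLinearMap ^ p) f) := by
  rw [polarizationOp_apply, Finset.sum_eq_single j, partialDeriv_pow_colSubst, map_mul, colSubst_X]
  · intro j' _ hj'
    obtain ⟨q, rfl⟩ := Nat.exists_eq_add_of_le' hp
    rw [pow_succ, Module.End.mul_apply, partialDeriv_colSubst, if_neg (Ne.symm hj'), map_zero,
      mul_zero]
  · simp

theorem colSubst_monomial (j : Fin n) (α : Fin ℓ →₀ ℕ) :
    colSubst K ℓ j (monomial α 1) = monomial (α.mapDomain fun i => (i, j)) 1 :=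
  rename_monomial _ _ _

theorem isWeightedHomogeneous_colSubst (j : Fin n) (α : Fin ℓ →₀ ℕ) :
    IsWeightedHomogeneous rowWeight (colSubst K ℓ j (monomial α 1)) α := by
  rw [colSubst_monomial]
  refine isWeightedHomogeneous_monomial _ _ _ ?_
  rw [Finsupp.weight_apply, Finsupp.sum_mapDomain_index (by simp) (by simp [add_smul]),
    Finsupp.sum_fintype _ _ (by simp)]
  exact sum_smul_single α

/-- The spanning vectors of the module generated by the `d`-th power sum. -/
def psumBasis (K : Type*) [Field K] (ℓ n d : ℕ) :
    Fin n × {α : Fin ℓ →₀ ℕ // α.degree < d} ⊕ {α : Fin ℓ →₀ ℕ // α.degree = d} → Poly K ℓ n :=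
  Sum.elim (fun x => colSubst K ℓ x.1 (monomial x.2.1 1))
    fun α => ∑ j, colSubst K ℓ j (monomial α.1 1)

theorem diagRep_sum_colSubst (σ : Equiv.Perm (Fin n)) (f : MvPolynomial (Fin ℓ) K) :
    diagRep K ℓ n σ (∑ j, colSubst K ℓ j f) = ∑ j, colSubst K ℓ j f := by
  rw [map_sum]
  simp only [diagRep_colSubst]
  exact Equiv.sum_comp σ fun j => colSubst K ℓ j f

theorem inRow_psum (i₀ : Fin ℓ) (d : ℕ) :
    inRow i₀ (psum (Fin n) K d) = ∑ j, colSubst K ℓ j (monomial (Finsupp.single i₀ d) 1) := by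
  simp only [← X_pow_eq_monomial, map_pow, colSubst_X, inRow, psum, map_sum, rename_X]

theorem partialDeriv_sum_colSubst (i : Fin ℓ) (j : Fin n) (f : MvPolynomial (Fin ℓ) K) :
    partialDeriv i j (∑ j', colSubst K ℓ j' f) = colSubst K ℓ j (pderiv i f) := by
  rw [map_sum, Finset.sum_congr rfl fun j' _ => partialDeriv_colSubst i j' j f]
  simp

theorem polarizationOp_sum_colSubst (i k : Fin ℓ) {p : ℕ} (hp : 1 ≤ p)
    (f : MvPolynomial (Fin ℓ) K) :
    polarizationOp i k p (∑ j : Fin n, colSubst K ℓ j f)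
      = ∑ j : Fin n, colSubst K ℓ j (X i * ((pderiv (R := K) k).toLinearMap ^ p) f) := by
  rw [map_sum]
  exact Finset.sum_congr rfl fun j _ => polarizationOp_colSubst i k hp j f

/-- A derivative of a symmetric sum isolates a single column, so below degree `d` the columns appear
separately. In degree `d` only polarizations act, and they treat all columns alike. -/
theorem polarizationModuleOf_psum [CharZero K] (i₀ : Fin ℓ) (d : ℕ) :
    (polarizationModuleOf (inRow i₀ (psum (Fin n) K d))).toSubmodule
      = Submodule.span K (Set.range (psumBasis K ℓ n d)) := by
  have hcol : ∀ (j : Fin n) (c : K) (β : Fin ℓ →₀ ℕ), β.degree < d →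
      colSubst K ℓ j (c • monomial β 1) ∈ Submodule.span K (Set.range (psumBasis K ℓ n d)) :=
    fun j c β hβ => by
      rw [map_smul]
      exact Submodule.smul_mem _ _ (Submodule.subset_span ⟨Sum.inl ⟨j, β, hβ⟩, rfl⟩)
  have hsum : ∀ (c : K) (β : Fin ℓ →₀ ℕ), β.degree ≤ d →
      ∑ j, colSubst K ℓ j (c • monomial β 1)
        ∈ Submodule.span K (Set.range (psumBasis K ℓ n d)) := fun c β hβ => by
    rcases hβ.eq_or_lt with h | h
    · simp only [map_smul]
      rw [← Finset.smul_sum]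
      exact Submodule.smul_mem _ _ (Submodule.subset_span ⟨Sum.inr ⟨β, h⟩, rfl⟩)
    · exact Submodule.sum_mem _ fun j _ => hcol j c β h
  rw [inRow_psum]
  refine polarizationModuleOf_toSubmodule_eq_span _ (fun σ => diagRep_sum_colSubst σ _) _ ?_ ?_ ?_ ?_
  · exact Submodule.subset_span ⟨Sum.inr ⟨_, Finsupp.degree_single _ _⟩, rfl⟩
  · rintro i j _ ⟨⟨j', α, hα⟩ | ⟨α, hα⟩, rfl⟩
    · change partialDeriv i j (colSubst K ℓ j' (monomial α 1)) ∈ _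
      rw [partialDeriv_colSubst]
      split_ifs
      · rcases pderiv_monomial_eq_zero_or (K := K) i α with h | ⟨c, β, h, hβ⟩
        · rw [h, map_zero]
          exact Submodule.zero_mem _
        · rw [h]
          exact hcol _ _ _ (by omega)
      · exact Submodule.zero_mem _
    · change partialDeriv i j (∑ j, colSubst K ℓ j (monomial α 1)) ∈ _
      rw [partialDeriv_sum_colSubst]
      rcases pderiv_monomial_eq_zero_or (K := K) i α with h | ⟨c, β, h, hβ⟩
      · rw [h, map_zero]
        exact Submodule.zero_mem _
      · rw [h]
        exact hcol _ _ _ (by omega)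
  · rintro i k p hp _ ⟨⟨j, α, hα⟩ | ⟨α, hα⟩, rfl⟩
    · change polarizationOp i k p (colSubst K ℓ j (monomial α 1)) ∈ _
      rw [polarizationOp_colSubst i k hp]
      rcases X_mul_pderiv_pow_monomial (K := K) i k p α with h | ⟨c, β, h, hβ⟩
      · rw [h, map_zero]
        exact Submodule.zero_mem _
      · rw [h]
        exact hcol _ _ _ (by omega)
    · change polarizationOp i k p (∑ j, colSubst K ℓ j (monomial α 1)) ∈ _
      rw [polarizationOp_sum_colSubst i k hp]
      rcases X_mul_pderiv_pow_monomial (K := K) i k p α with h | ⟨c, β, h, hβ⟩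
      · simp only [h, map_zero, Finset.sum_const_zero]
        exact Submodule.zero_mem _
      · rw [h]
        exact hsum _ _ (by omega)
  · intro V hfV hVd hVp
    have htop : ∀ α : Fin ℓ →₀ ℕ, α.degree = d → ∑ j, colSubst K ℓ j (monomial α 1) ∈ V := by
      refine degree_eq_induction i₀ d hfV fun β i hβ => ?_
      have := hVp i i₀ 1 le_rfl _ hβ
      rw [polarizationOp_sum_colSubst i i₀ le_rfl, X_mul_pderiv_monomial_add_single] at this
      simp only [map_smul] at this
      rw [← Finset.smul_sum] at this
      exact (Submodule.smul_mem_iff _ (Nat.cast_ne_zero.2 (Nat.succ_ne_zero _))).1 this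
    rintro _ ⟨⟨j, α, hα⟩ | ⟨α, hα⟩, rfl⟩
    · change colSubst K ℓ j (monomial α 1) ∈ V
      induction hm : d - α.degree generalizing α with
      | zero => omega
      | succ m ih =>
        have hdeg : (α + Finsupp.single i₀ 1).degree = α.degree + 1 := by
          rw [map_add, Finsupp.degree_single]
        have : colSubst K ℓ j (((α i₀ + 1 : ℕ) : K) • monomial α 1) ∈ V := by
          rw [← pderiv_monomial_add_single]
          -- The first descent starts from the symmetric sum in degree `d`; later ones stay within
          -- the column `j`.
          by_cases hd : α.degree + 1 = d
          · rw [← partialDeriv_sum_colSubst]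
            exact hVd _ _ _ (htop _ (by omega))
          · have := hVd i₀ j _ (ih (α + Finsupp.single i₀ 1) (by omega) (by omega))
            rwa [partialDeriv_colSubst, if_pos rfl] at this
        rw [map_smul] at this
        exact (Submodule.smul_mem_iff _ (Nat.cast_ne_zero.2 (Nat.succ_ne_zero _))).1 this
    · exact htop α hα

/-- A nonconstant monomial placed in different columns gives different monomials. -/
theorem linearIndependent_colSubst {α : Fin ℓ →₀ ℕ} (hα : α ≠ 0) :
    LinearIndependent K fun j : Fin n => colSubst K ℓ j (monomial α 1) := by
  have hinj : Function.Injective fun j : Fin n => α.mapDomain fun i => (i, j) := by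
    intro j j' h
    obtain ⟨i, hi⟩ := Finsupp.ne_iff.1 hα
    by_contra hne
    have h1 := DFunLike.congr_fun h (i, j)
    rw [Finsupp.mapDomain_apply (fun a b h => congrArg Prod.fst h),
      Finsupp.mapDomain_of_notMem_range] at h1
    · exact hi h1
    · rintro ⟨k, hk⟩
      exact hne (congrArg Prod.snd hk).symm
  simp only [colSubst_monomial]
  have := (basisMonomials (Fin ℓ × Fin n) K).linearIndependent.comp _ hinj
  simpa [Function.comp_def] using this

/-- In degree `0` all columns give the same vector `1`, in degree `d` only the symmetric sum is
present, and in between the `n` columns are independent and permuted. -/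
theorem coeff_frobeniusChar_psum [CharZero K] (i₀ : Fin ℓ) (hn : 1 ≤ n) {d : ℕ} (hd : 1 ≤ d)
    (δ : Fin ℓ →₀ ℕ) :
    MvPowerSeries.coeff δ (frobeniusChar (polarizationModuleOf (inRow i₀ (psum (Fin n) K d))))
      = if δ.degree = 0 ∨ δ.degree = d then completeHomog ℕ K n
        else if δ.degree < d then completeHomog ℕ K (n - 1) * completeHomog ℕ K 1 else 0 := by
  have hcomp := component_toSubmodule_of_span (psumBasis K ℓ n d)
    (Sum.elim (fun x => x.2.1) fun α => α.1) (by
      rintro (⟨j, α⟩ | α)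
      · exact isWeightedHomogeneous_colSubst (K := K) j α.1
      · exact IsWeightedHomogeneous.sum Finset.univ _ α.1 fun j _ =>
          isWeightedHomogeneous_colSubst (K := K) j α.1) _
    (polarizationModuleOf_psum i₀ d) δ
  have huniq : Unique {S : Finset (Fin n) // S.card = 0} :=
    ⟨⟨⟨∅, rfl⟩⟩, fun S => Subtype.ext (Finset.card_eq_zero.1 S.2)⟩
  have htriv : ∀ v : Poly K ℓ n, v ≠ 0 → (∀ σ, diagRep K ℓ n σ v = v) →
      (component (polarizationModuleOf (inRow i₀ (psum (Fin n) K d))) δ).toSubmodule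
        = Submodule.span K {v} →
      MvPowerSeries.coeff δ (frobeniusChar (polarizationModuleOf (inRow i₀ (psum (Fin n) K d))))
        = completeHomog ℕ K n := fun v hv hσ h => by
    rw [coeff_frobeniusChar_of_basis (Nat.zero_le n) _ δ (fun _ => v), completeHomog_zero, mul_one,
      Nat.sub_zero]
    · exact LinearIndependent.of_subsingleton default hv
    · rw [h, show (fun _ => v) '' {S : Finset (Fin n) | S.card = 0} = {v} from
        Set.Nonempty.image_const ⟨∅, Finset.card_empty⟩ v]
    · exact fun σ S _ => hσ σ
  split_ifs with h1 h2
  · rcases h1 with h1 | h1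
    · have hδ : δ = 0 := (Finsupp.degree_eq_zero_iff δ).1 h1
      refine htriv 1 one_ne_zero (fun σ => by rw [diagRep_apply, map_one]) ?_
      rw [hcomp]
      congr 1
      ext x
      constructor
      · rintro ⟨⟨j, α, hα⟩ | ⟨α, hα⟩, h, rfl⟩
        · obtain rfl : α = 0 := h.trans hδ
          simp [psumBasis]
        · obtain rfl : α = 0 := h.trans hδ
          rw [map_zero] at hα
          omega
      · rintro rfl
        exact ⟨Sum.inl ⟨⟨0, hn⟩, δ, by omega⟩, rfl, by simp [psumBasis, hδ]⟩
    · have hδ : δ ≠ 0 := by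
        rintro rfl
        rw [map_zero] at h1
        omega
      refine htriv (∑ j, colSubst K ℓ j (monomial δ 1)) (fun h => ?_)
        (fun σ => diagRep_sum_colSubst σ _) ?_
      · have := Fintype.linearIndependent_iff.1 (linearIndependent_colSubst (K := K) (n := n) hδ)
          (fun _ => 1) (by simpa using h) ⟨0, hn⟩
        exact one_ne_zero this
      · rw [hcomp]
        congr 1
        ext x
        constructor
        · rintro ⟨⟨j, α, hα⟩ | ⟨α, hα⟩, h, rfl⟩
          · obtain rfl : α = δ := h
            omega
          · obtain rfl : α = δ := h
            rfl
        · rintro rfl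
          exact ⟨Sum.inr ⟨δ, h1⟩, rfl, rfl⟩
  · push Not at h1
    have hδ : δ ≠ 0 := by
      rintro rfl
      exact h1.1 (map_zero _)
    -- Summing over a one-element set `S` evaluates at its element.
    rw [coeff_frobeniusChar_of_basis hn _ δ
      (fun S => ∑ j ∈ S, colSubst K ℓ j (monomial δ 1))]
    · have hli := linearIndependent_colSubst (K := K) (n := n) hδ
      choose g hg using fun S : {S : Finset (Fin n) // S.card = 1} => Finset.card_eq_one.1 S.2
      have hginj : Function.Injective g := fun S T h => Subtype.ext (by rw [hg, hg, h])
      convert hli.comp g hginj using 2 with S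
      rw [hg S, Finset.sum_singleton]
      rfl
    · rw [hcomp]
      congr 1
      ext x
      constructor
      · rintro ⟨⟨j, α, hα⟩ | ⟨α, hα⟩, h, rfl⟩
        · obtain rfl : α = δ := h
          exact ⟨{j}, Finset.card_singleton j, Finset.sum_singleton _ _⟩
        · obtain rfl : α = δ := h
          omega
      · rintro ⟨S, hS, rfl⟩
        obtain ⟨j, rfl⟩ := Finset.card_eq_one.1 hS
        exact ⟨Sum.inl ⟨j, δ, h2⟩, rfl, (Finset.sum_singleton _ _).symm⟩
    · intro σ S _
      rw [map_sum, Finset.sum_map]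
      exact Finset.sum_congr rfl fun j _ => diagRep_colSubst σ j _
  · refine coeff_frobeniusChar_of_bot _ _ ?_
    rw [hcomp, show {x : Fin n × {α : Fin ℓ →₀ ℕ // α.degree < d} ⊕
      {α : Fin ℓ →₀ ℕ // α.degree = d} | Sum.elim (fun x => x.2.1) (fun α => α.1) x = δ} = ∅ from ?_,
      Set.image_empty, Submodule.span_empty]
    rw [Set.eq_empty_iff_forall_notMem]
    rintro (⟨j, α, hα⟩ | ⟨α, hα⟩) h
    · obtain rfl : α = δ := h
      exact h2 hα
    · obtain rfl : α = δ := h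
      exact h1 (Or.inr hα)

end PowerSums

section Elementary

open MvPolynomial

variable {K : Type*} [Field K] {ℓ n : ℕ}

/-! ### The disjointness matrix of subsets -/

/-- Enlarge `T` by one element in all possible ways. A set `U` disjoint from `T` is counted `n - |T|
- a` times, a positive number as long as `|T| < b`. -/
theorem sum_disjoint_eq_zero_of_le [CharZero K] {f : Finset (Fin n) → K} {a b : ℕ} (hn : a + b ≤ n)
    (h : ∀ T : Finset (Fin n), T.card = b →
      ∑ U ∈ (Finset.powersetCard a Finset.univ).filter (Disjoint T), f U = 0)
    (T : Finset (Fin n)) (hT : T.card ≤ b) :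
    ∑ U ∈ (Finset.powersetCard a Finset.univ).filter (Disjoint T), f U = 0 := by
  classical
  induction hm : b - T.card generalizing T with
  | zero => exact h T (by omega)
  | succ m ih =>
    have h1 : ∑ x ∈ Tᶜ, ∑ U ∈ (Finset.powersetCard a Finset.univ).filter (Disjoint (insert x T)),
        f U = 0 := by
      refine Finset.sum_eq_zero fun x hx => ih _ ?_ ?_ <;>
      · rw [Finset.card_insert_of_notMem (Finset.mem_compl.1 hx)]
        omega
    have h2 : ∑ x ∈ Tᶜ, ∑ U ∈ (Finset.powersetCard a Finset.univ).filter (Disjoint (insert x T)),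
        f U = ((n - T.card - a : ℕ) : K)
          * ∑ U ∈ (Finset.powersetCard a Finset.univ).filter (Disjoint T), f U := by
      rw [Finset.mul_sum]
      rw [Finset.sum_comm' (t' := (Finset.powersetCard a Finset.univ).filter (Disjoint T))
        (s' := fun U => Tᶜ \ U)]
      · refine Finset.sum_congr rfl fun U hU => ?_
        obtain ⟨hU, hd⟩ := Finset.mem_filter.1 hU
        have hsub : U ⊆ Tᶜ := fun x hx =>
          Finset.mem_compl.2 fun hxT => Finset.disjoint_left.1 hd hxT hx
        rw [Finset.sum_const, Finset.card_sdiff_of_subset hsub, Finset.card_compl,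
          Fintype.card_fin, (Finset.mem_powersetCard.1 hU).2, nsmul_eq_mul]
      · intro x U
        simp only [Finset.mem_compl, Finset.mem_filter, Finset.disjoint_insert_left,
          Finset.mem_sdiff]
        tauto
    rw [h1] at h2
    refine (mul_eq_zero.1 h2.symm).resolve_left (Nat.cast_ne_zero.2 ?_)
    omega

/-- The disjointness matrix between `a`-subsets and `b`-subsets of an `n`-set has full rank. -/
theorem eq_zero_of_sum_disjoint_eq_zero [CharZero K] {f : Finset (Fin n) → K} {a b : ℕ}
    (hab : a ≤ b) (hn : a + b ≤ n)
    (h : ∀ T : Finset (Fin n), T.card = b →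
      ∑ U ∈ (Finset.powersetCard a Finset.univ).filter (Disjoint T), f U = 0)
    (W : Finset (Fin n)) (hW : W.card = a) : f W = 0 := by
  classical
  -- Inclusion–exclusion over `T ⊆ W`: the coefficient of `f U` is the alternating sum over subsets
  -- of `W \ U`, which vanishes unless `W ⊆ U`, and then `U = W` by cardinality.
  have h1 : ∑ T ∈ W.powerset, (-1 : K) ^ T.card
      * ∑ U ∈ (Finset.powersetCard a Finset.univ).filter (Disjoint T), f U = 0 := by
    refine Finset.sum_eq_zero fun T hT => ?_
    rw [sum_disjoint_eq_zero_of_le hn h T, mul_zero]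
    exact (Finset.card_le_card (Finset.mem_powerset.1 hT)).trans (hW.trans_le hab)
  have hie : ∀ A : Finset (Fin n), ∑ T ∈ A.powerset, (-1 : K) ^ T.card = if A = ∅ then 1 else 0 := by
    intro A
    have := congrArg (Int.cast : ℤ → K) (Finset.sum_powerset_neg_one_pow_card (x := A))
    push_cast at this
    exact this
  simp only [Finset.mul_sum] at h1
  rw [Finset.sum_comm' (t' := Finset.powersetCard a Finset.univ)
    (s' := fun U => (W \ U).powerset)] at h1
  · simp only [← Finset.sum_mul, hie] at h1
    rw [Finset.sum_eq_single W] at h1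
    · simpa using h1
    · intro U hU hne
      rw [if_neg, zero_mul]
      rw [Finset.sdiff_eq_empty_iff_subset]
      intro hs
      exact hne (Finset.eq_of_subset_of_card_le hs
        ((Finset.mem_powersetCard.1 hU).2.trans hW.symm).le).symm
    · intro hc
      exact absurd (Finset.mem_powersetCard.2 ⟨Finset.subset_univ _, hW⟩) hc
  · intro T U
    simp only [Finset.mem_powerset, Finset.mem_filter, Finset.subset_sdiff]
    tauto

/-! ### Polarized elementary symmetric polynomials -/

/-- The exponent of `∏_j x_{φ(j),j}`, the product being over the columns `j` labelled by `φ`. -/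
def cellExponent (φ : Fin n → Option (Fin ℓ)) : Fin ℓ × Fin n →₀ ℕ :=
  ∑ j, (φ j).elim 0 fun i => Finsupp.single (i, j) 1

/-- How often each label occurs. -/
def labelContent (φ : Fin n → Option (Fin ℓ)) : Fin ℓ →₀ ℕ :=
  ∑ j, (φ j).elim 0 fun i => Finsupp.single i 1

/-- The columns with a label. -/
def labelled (φ : Fin n → Option (Fin ℓ)) : Finset (Fin n) :=
  Finset.univ.filter fun j => φ j ≠ none

theorem mem_labelled {φ : Fin n → Option (Fin ℓ)} {j : Fin n} : j ∈ labelled φ ↔ φ j ≠ none := by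
  simp [labelled]

theorem cellExponent_apply (φ : Fin n → Option (Fin ℓ)) (i : Fin ℓ) (j : Fin n) :
    cellExponent φ (i, j) = if φ j = some i then 1 else 0 := by
  rw [cellExponent, Finsupp.finsetSum_apply, Finset.sum_eq_single j]
  · rcases φ j with _ | k <;> simp [Finsupp.single_apply]
  · intro j' _ hj'
    rcases φ j' with _ | k <;> simp [hj']
  · simp

theorem labelContent_apply (φ : Fin n → Option (Fin ℓ)) (i : Fin ℓ) :
    labelContent φ i = (Finset.univ.filter fun j => φ j = some i).card := by
  rw [labelContent, Finsupp.finsetSum_apply, Finset.card_filter]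
  refine Finset.sum_congr rfl fun j _ => ?_
  rcases φ j with _ | k <;> simp [Finsupp.single_apply]

theorem degree_labelContent (φ : Fin n → Option (Fin ℓ)) :
    (labelContent φ).degree = (labelled φ).card := by
  rw [labelContent, map_sum, labelled, Finset.card_filter]
  refine Finset.sum_congr rfl fun j _ => ?_
  rcases φ j with _ | k <;> simp

theorem cellExponent_injective :
    Function.Injective (cellExponent : (Fin n → Option (Fin ℓ)) → Fin ℓ × Fin n →₀ ℕ) := by
  intro φ ψ h
  funext j
  have : ∀ i, φ j = some i ↔ ψ j = some i := fun i => by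
    have := DFunLike.congr_fun h (i, j)
    rw [cellExponent_apply, cellExponent_apply] at this
    by_cases h1 : φ j = some i <;> by_cases h2 : ψ j = some i <;> simp_all
  exact Option.ext this

theorem weight_rowWeight_single (x : Fin ℓ × Fin n) :
    Finsupp.weight rowWeight (Finsupp.single x 1) = Finsupp.single x.1 1 := by
  rw [Finsupp.weight_apply, Finsupp.sum_single_index (by simp), one_smul, rowWeight]

theorem weight_cellExponent (φ : Fin n → Option (Fin ℓ)) :
    Finsupp.weight rowWeight (cellExponent φ) = labelContent φ := by
  rw [cellExponent, labelContent, map_sum]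
  refine Finset.sum_congr rfl fun j _ => ?_
  rcases φ j with _ | k
  · simp
  · exact weight_rowWeight_single (k, j)

theorem cellExponent_update (φ : Fin n → Option (Fin ℓ)) {j : Fin n} (hj : φ j = none)
    (i : Fin ℓ) :
    cellExponent (Function.update φ j (some i)) = cellExponent φ + Finsupp.single (i, j) 1 := by
  ext ⟨i', j'⟩
  rw [Finsupp.add_apply, cellExponent_apply, cellExponent_apply, Finsupp.single_apply]
  by_cases h : j' = j
  · subst h
    simp [hj]
  · rw [Function.update_of_ne h, if_neg (fun h' : (i, j) = (i', j') => h (congrArg Prod.snd h').symm),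
      add_zero]

theorem labelContent_update (φ : Fin n → Option (Fin ℓ)) {j : Fin n} (hj : φ j = none)
    (i : Fin ℓ) :
    labelContent (Function.update φ j (some i)) = labelContent φ + Finsupp.single i 1 := by
  rw [← weight_cellExponent, cellExponent_update φ hj, map_add, weight_cellExponent,
    weight_rowWeight_single]

/-- The labellings with content `δ` which leave the columns in `S` free. -/
def labellings (δ : Fin ℓ →₀ ℕ) (S : Finset (Fin n)) : Finset (Fin n → Option (Fin ℓ)) :=
  Finset.univ.filter fun φ => (∀ j ∈ S, φ j = none) ∧ labelContent φ = δ

theorem mem_labellings {δ : Fin ℓ →₀ ℕ} {S : Finset (Fin n)} {φ : Fin n → Option (Fin ℓ)} :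
    φ ∈ labellings δ S ↔ (∀ j ∈ S, φ j = none) ∧ labelContent φ = δ := by
  simp [labellings]

variable (K) in
/-- The polarization of degree `δ` of the elementary symmetric polynomial in the columns outside
of `S`. -/
def polarizedEsymm (δ : Fin ℓ →₀ ℕ) (S : Finset (Fin n)) : Poly K ℓ n :=
  ∑ φ ∈ labellings δ S, monomial (cellExponent φ) 1

theorem isWeightedHomogeneous_polarizedEsymm (δ : Fin ℓ →₀ ℕ) (S : Finset (Fin n)) :
    IsWeightedHomogeneous rowWeight (polarizedEsymm K δ S) δ :=
  IsWeightedHomogeneous.sum _ _ _ fun φ hφ => isWeightedHomogeneous_monomial _ _ _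
    ((weight_cellExponent φ).trans (mem_labellings.1 hφ).2)

/-- Different labellings have different monomials, so these coefficients are the entries of a
disjointness matrix. -/
theorem coeff_polarizedEsymm (δ : Fin ℓ →₀ ℕ) (S : Finset (Fin n)) {ψ : Fin n → Option (Fin ℓ)}
    (hψ : labelContent ψ = δ) :
    coeff (cellExponent ψ) (polarizedEsymm K δ S) = if Disjoint (labelled ψ) S then 1 else 0 := by
  classical
  rw [polarizedEsymm, coeff_sum]
  simp only [coeff_monomial, cellExponent_injective.eq_iff, Finset.sum_ite_eq', mem_labellings, hψ,
    and_true, Finset.disjoint_right, mem_labelled, not_not]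

theorem diagRep_polarizedEsymm (σ : Equiv.Perm (Fin n)) (δ : Fin ℓ →₀ ℕ) (S : Finset (Fin n)) :
    diagRep K ℓ n σ (polarizedEsymm K δ S) = polarizedEsymm K δ (S.map σ.toEmbedding) := by
  have hcontent : ∀ (τ : Equiv.Perm (Fin n)) (φ : Fin n → Option (Fin ℓ)),
      labelContent (φ ∘ τ) = labelContent φ := fun τ φ =>
    Equiv.sum_comp τ fun j => (φ j).elim 0 fun i => Finsupp.single i 1
  rw [polarizedEsymm, polarizedEsymm, map_sum]
  refine Finset.sum_nbij' (fun φ => φ ∘ σ.symm) (fun φ => φ ∘ σ) ?_ ?_ ?_ ?_ ?_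
  · intro φ hφ
    rw [mem_labellings] at hφ ⊢
    refine ⟨fun j hj => hφ.1 _ ?_, by rw [hcontent, hφ.2]⟩
    rwa [Finset.mem_map_equiv] at hj
  · intro φ hφ
    rw [mem_labellings] at hφ ⊢
    exact ⟨fun j hj => hφ.1 _ (by simpa using hj), by rw [hcontent, hφ.2]⟩
  · intro φ _
    funext j
    simp
  · intro φ _
    funext j
    simp
  · intro φ _
    rw [diagRep_apply, rename_monomial]
    refine congrArg (fun e => monomial e (1 : K)) ?_
    rw [cellExponent, cellExponent, Finsupp.mapDomain_finsetSum]
    refine Eq.trans ?_ (Equiv.sum_comp σ _)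
    refine Finset.sum_congr rfl fun j _ => ?_
    rw [Function.comp_apply, Equiv.symm_apply_apply]
    rcases φ j with _ | i <;> simp

theorem pderiv_monomial_cellExponent (φ : Fin n → Option (Fin ℓ)) (i : Fin ℓ) (j : Fin n) :
    pderiv (i, j) (monomial (cellExponent φ) (1 : K))
      = if φ j = some i then monomial (cellExponent (Function.update φ j none)) 1 else 0 := by
  rw [pderiv_monomial, cellExponent_apply]
  split_ifs with h
  · have : cellExponent φ = cellExponent (Function.update φ j none) + Finsupp.single (i, j) 1 := by
      rw [← cellExponent_update _ (by simp), Function.update_idem, ← h, Function.update_eq_self]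
    rw [this, add_tsub_cancel_right]
    simp
  · simp

theorem partialDeriv_polarizedEsymm (i : Fin ℓ) (j : Fin n) (δ : Fin ℓ →₀ ℕ)
    (S : Finset (Fin n)) :
    partialDeriv i j (polarizedEsymm K δ S)
      = ∑ φ ∈ (labellings δ S).filter fun φ => φ j = some i,
          monomial (cellExponent (Function.update φ j none)) 1 := by
  rw [polarizedEsymm, map_sum, Finset.sum_filter]
  exact Finset.sum_congr rfl fun φ _ => pderiv_monomial_cellExponent φ i j

theorem partialDeriv_polarizedEsymm_eq_zero (i : Fin ℓ) (j : Fin n) {δ : Fin ℓ →₀ ℕ}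
    {S : Finset (Fin n)} (h : j ∈ S ∨ δ i = 0) : partialDeriv i j (polarizedEsymm K δ S) = 0 := by
  rw [partialDeriv_polarizedEsymm, Finset.sum_eq_zero]
  intro φ hφ
  obtain ⟨hφ, hj⟩ := Finset.mem_filter.1 hφ
  obtain ⟨h1, h2⟩ := mem_labellings.1 hφ
  exfalso
  rcases h with h | h
  · rw [h1 j h] at hj
    exact absurd hj (by simp)
  · rw [← h2, labelContent_apply, Finset.card_eq_zero] at h
    exact Finset.notMem_empty j (h ▸ Finset.mem_filter.2 ⟨Finset.mem_univ _, hj⟩)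

/-- Erasing the label `i` of column `j` is a bijection onto the labellings that also leave `j` free.
-/
theorem partialDeriv_polarizedEsymm_add_single (i : Fin ℓ) {j : Fin n} (δ : Fin ℓ →₀ ℕ)
    {S : Finset (Fin n)} (hj : j ∉ S) :
    partialDeriv i j (polarizedEsymm K (δ + Finsupp.single i 1) S)
      = polarizedEsymm K δ (insert j S) := by
  rw [partialDeriv_polarizedEsymm, polarizedEsymm]
  refine Finset.sum_nbij' (fun φ => Function.update φ j none)
    (fun φ => Function.update φ j (some i)) ?_ ?_ ?_ ?_ fun _ _ => rfl
  · intro φ hφ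
    rw [Finset.mem_filter, mem_labellings] at hφ
    rw [mem_labellings]
    refine ⟨fun j' hj' => ?_, ?_⟩
    · by_cases h : j' = j
      · simp [h]
      · rw [Function.update_of_ne h]
        exact hφ.1.1 _ (Finset.mem_of_mem_insert_of_ne hj' h)
    · have := labelContent_update (Function.update φ j none) (j := j) (by simp) i
      rw [Function.update_idem, ← hφ.2, Function.update_eq_self, hφ.1.2] at this
      exact (add_right_cancel this).symm
  · intro φ hφ
    rw [mem_labellings] at hφ
    rw [Finset.mem_filter, mem_labellings]
    refine ⟨⟨fun j' hj' => ?_, ?_⟩, by simp⟩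
    · have h : j' ≠ j := fun h => hj (h ▸ hj')
      rw [Function.update_of_ne h]
      exact hφ.1 _ (Finset.mem_insert_of_mem hj')
    · rw [labelContent_update _ (hφ.1 j (Finset.mem_insert_self _ _)), hφ.2]
  · intro φ hφ
    have := (Finset.mem_filter.1 hφ).2
    rw [Function.update_idem, ← this, Function.update_eq_self]
  · intro φ hφ
    have := (mem_labellings.1 hφ).1 j (Finset.mem_insert_self _ _)
    rw [Function.update_idem, ← this, Function.update_eq_self]

theorem partialDeriv_partialDeriv_polarizedEsymm (i : Fin ℓ) (j : Fin n) (δ : Fin ℓ →₀ ℕ)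
    (S : Finset (Fin n)) :
    partialDeriv i j (partialDeriv i j (polarizedEsymm K δ S)) = 0 := by
  rw [partialDeriv_polarizedEsymm, map_sum]
  refine Finset.sum_eq_zero fun φ _ => ?_
  refine (pderiv_monomial_cellExponent _ i j).trans (if_neg ?_)
  simp

/-- The polynomial has degree at most one in each variable, and it involves no variable of row `k`
if `δ k = 0`. -/
theorem polarizationOp_polarizedEsymm_eq_zero (i k : Fin ℓ) {p : ℕ} (hp : 1 ≤ p)
    {δ : Fin ℓ →₀ ℕ} (S : Finset (Fin n)) (h : 2 ≤ p ∨ δ k = 0) :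
    polarizationOp i k p (polarizedEsymm K δ S) = 0 := by
  rw [polarizationOp_apply]
  refine Finset.sum_eq_zero fun j _ => ?_
  rcases h with h | h
  · obtain ⟨q, rfl⟩ := Nat.exists_eq_add_of_le' h
    rw [pow_add, Module.End.mul_apply, pow_two, Module.End.mul_apply,
      partialDeriv_partialDeriv_polarizedEsymm, map_zero, mul_zero]
  · obtain ⟨q, rfl⟩ := Nat.exists_eq_add_of_le' hp
    rw [pow_succ, Module.End.mul_apply, partialDeriv_polarizedEsymm_eq_zero k j (Or.inr h),
      map_zero, mul_zero]

/-- The summand of column `j` changes its label from `k` to `i`. A resulting labelling arises once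
from each of its columns labelled `i`, of which there are `δ i + 1`. -/
theorem polarizationOp_polarizedEsymm_add_single (i k : Fin ℓ) (δ : Fin ℓ →₀ ℕ)
    (S : Finset (Fin n)) :
    polarizationOp i k 1 (polarizedEsymm K (δ + Finsupp.single k 1) S)
      = ((δ i + 1 : ℕ) : K) • polarizedEsymm K (δ + Finsupp.single i 1) S := by
  have hcol : ∀ j, X (i, j) * partialDeriv k j (polarizedEsymm K (δ + Finsupp.single k 1) S)
      = ∑ ψ ∈ (labellings (δ + Finsupp.single i 1) S).filter fun ψ => ψ j = some i,
          monomial (cellExponent ψ) (1 : K) := by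
    intro j
    by_cases hj : j ∈ S
    · rw [partialDeriv_polarizedEsymm_eq_zero k j (Or.inl hj), mul_zero, Finset.sum_eq_zero]
      intro ψ hψ
      rw [Finset.mem_filter, mem_labellings] at hψ
      rw [hψ.1.1 j hj] at hψ
      exact absurd hψ.2 (by simp)
    · have h1 := partialDeriv_polarizedEsymm_add_single (K := K) k δ hj
      have h2 := partialDeriv_polarizedEsymm_add_single (K := K) i δ hj
      rw [h1, ← h2, partialDeriv_polarizedEsymm, Finset.mul_sum]
      refine Finset.sum_congr rfl fun ψ hψ => ?_
      have hψj := (Finset.mem_filter.1 hψ).2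
      rw [X, monomial_mul, one_mul, add_comm, ← cellExponent_update _ (by simp),
        Function.update_idem, ← hψj, Function.update_eq_self]
  rw [polarizationOp_apply]
  simp only [pow_one, hcol, Finset.sum_filter]
  rw [Finset.sum_comm, polarizedEsymm, Finset.smul_sum]
  refine Finset.sum_congr rfl fun ψ hψ => ?_
  rw [← Finset.sum_filter, Finset.sum_const, ← labelContent_apply, (mem_labellings.1 hψ).2,
    Finsupp.add_apply, Finsupp.single_eq_same, Nat.cast_smul_eq_nsmul]

theorem inRow_esymm (i₀ : Fin ℓ) (d : ℕ) :
    inRow i₀ (esymm (Fin n) K d) = polarizedEsymm K (Finsupp.single i₀ d) ∅ := by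
  classical
  rw [inRow, esymm, map_sum, polarizedEsymm]
  have hlab : ∀ t : Finset (Fin n), labelled (fun j => if j ∈ t then some i₀ else none) = t := by
    intro t
    ext j
    by_cases h : j ∈ t <;> simp [mem_labelled, h]
  have hcont : ∀ t : Finset (Fin n),
      labelContent (fun j => if j ∈ t then some i₀ else none) = Finsupp.single i₀ t.card := by
    intro t
    ext i
    rw [labelContent_apply, Finsupp.single_apply]
    split_ifs with h
    · subst h
      simp
    · rw [Finset.card_eq_zero, Finset.filter_eq_empty_iff]
      intro j _ hj
      by_cases hjt : j ∈ t <;> simp [hjt] at hj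
      exact h hj
  refine Finset.sum_nbij' (fun t j => if j ∈ t then some i₀ else none) labelled ?_ ?_ ?_ ?_ ?_
  · intro t ht
    rw [mem_labellings, hcont, (Finset.mem_powersetCard.1 ht).2]
    exact ⟨by simp, rfl⟩
  · intro φ hφ
    rw [Finset.mem_powersetCard, ← degree_labelContent, (mem_labellings.1 hφ).2,
      Finsupp.degree_single]
    exact ⟨Finset.subset_univ _, rfl⟩
  · exact fun t _ => hlab t
  · intro φ hφ
    have h2 := (mem_labellings.1 hφ).2
    funext j
    rcases hj : φ j with _ | i
    · simp [mem_labelled, hj]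
    · have hi : i = i₀ := by
        by_contra hne
        have := DFunLike.congr_fun h2 i
        rw [labelContent_apply, Finsupp.single_apply, if_neg (Ne.symm hne),
          Finset.card_eq_zero] at this
        exact Finset.notMem_empty j (this ▸ Finset.mem_filter.2 ⟨Finset.mem_univ _, hj⟩)
      simp [mem_labelled, hj, hi]
  · intro t _
    rw [map_prod]
    simp only [rename_X]
    have : cellExponent (fun j => if j ∈ t then some i₀ else none)
        = ∑ j ∈ t, Finsupp.single (i₀, j) 1 := by
      rw [cellExponent, ← Finset.sum_filter_add_sum_filter_not _ (· ∈ t)]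
      rw [Finset.sum_congr rfl (g := fun j => Finsupp.single (i₀, j) 1)
        (fun j hj => by simp [(Finset.mem_filter.1 hj).2]), Finset.sum_eq_zero
        (s := Finset.univ.filter (· ∉ t)) (fun j hj => by simp [(Finset.mem_filter.1 hj).2]),
        add_zero]
      simp
    rw [this, monomial_sum_one]
    rfl

/-- A nonzero derivative moves one unit from `|δ|` to `|S|`, and a nonzero polarization preserves
both, so `|S| + |δ| = d` persists. -/
theorem polarizationModuleOf_esymm [CharZero K] (i₀ : Fin ℓ) (d : ℕ) :
    (polarizationModuleOf (inRow i₀ (esymm (Fin n) K d))).toSubmodule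
      = Submodule.span K (Set.range
          fun x : {x : (Fin ℓ →₀ ℕ) × Finset (Fin n) // x.2.card + x.1.degree = d} =>
            polarizedEsymm K x.1.1 x.1.2) := by
  classical
  rw [inRow_esymm]
  refine polarizationModuleOf_toSubmodule_eq_span _ (fun σ => ?_) _ ?_ ?_ ?_ ?_
  · rw [diagRep_polarizedEsymm, Finset.map_empty]
  · exact Submodule.subset_span ⟨⟨(Finsupp.single i₀ d, ∅), by
      rw [Finset.card_empty, zero_add, Finsupp.degree_single]⟩, rfl⟩
  · rintro i j _ ⟨⟨⟨δ, S⟩, hx⟩, rfl⟩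
    dsimp only at hx ⊢
    by_cases h : j ∈ S ∨ δ i = 0
    · rw [partialDeriv_polarizedEsymm_eq_zero i j h]
      exact Submodule.zero_mem _
    · rw [not_or] at h
      obtain ⟨β, rfl⟩ := le_iff_exists_add'.1
        (Finsupp.single_le_iff.2 (Nat.one_le_iff_ne_zero.2 h.2))
      rw [partialDeriv_polarizedEsymm_add_single i β h.1]
      refine Submodule.subset_span ⟨⟨(β, insert j S), ?_⟩, rfl⟩
      rw [map_add, Finsupp.degree_single] at hx
      rw [Finset.card_insert_of_notMem h.1]
      dsimp only
      omega
  · rintro i k p hp _ ⟨⟨⟨δ, S⟩, hx⟩, rfl⟩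
    dsimp only at hx ⊢
    by_cases h : 2 ≤ p ∨ δ k = 0
    · rw [polarizationOp_polarizedEsymm_eq_zero i k hp S h]
      exact Submodule.zero_mem _
    · rw [not_or] at h
      obtain ⟨β, rfl⟩ := le_iff_exists_add'.1
        (Finsupp.single_le_iff.2 (Nat.one_le_iff_ne_zero.2 h.2))
      obtain rfl : p = 1 := by omega
      rw [polarizationOp_polarizedEsymm_add_single]
      refine Submodule.smul_mem _ _ (Submodule.subset_span
        ⟨⟨(β + Finsupp.single i 1, S), ?_⟩, rfl⟩)
      rw [map_add, Finsupp.degree_single] at hx ⊢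
      exact hx
  · intro V hfV hVd hVp
    have htop : ∀ δ : Fin ℓ →₀ ℕ, δ.degree = d → polarizedEsymm K δ (∅ : Finset (Fin n)) ∈ V := by
      refine degree_eq_induction i₀ d hfV fun β i hβ => ?_
      have := hVp i i₀ 1 le_rfl _ hβ
      rw [polarizationOp_polarizedEsymm_add_single] at this
      exact (Submodule.smul_mem_iff _ (Nat.cast_ne_zero.2 (Nat.succ_ne_zero _))).1 this
    rintro _ ⟨⟨⟨δ, S⟩, hx⟩, rfl⟩
    dsimp only at hx ⊢
    -- The columns of `S` are removed by derivatives in row `i₀`; each one is paid for by one more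
    -- unit in `δ`.
    induction S using Finset.induction_on generalizing δ with
    | empty => exact htop δ (by simpa using hx)
    | insert j S hj ih =>
      rw [← partialDeriv_polarizedEsymm_add_single i₀ δ hj]
      refine hVd _ _ _ (ih _ ?_)
      rw [Finset.card_insert_of_notMem hj] at hx
      rw [map_add, Finsupp.degree_single]
      omega

theorem exists_labelling (δ : Fin ℓ →₀ ℕ) (U : Finset (Fin n)) (hU : U.card = δ.degree) :
    ∃ ψ : Fin n → Option (Fin ℓ), labelled ψ = U ∧ labelContent ψ = δ := by
  classical
  obtain ⟨g, hg⟩ := exists_content_eq δ hU.symm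
  let ψ : Fin n → Option (Fin ℓ) := fun j =>
    if h : j ∈ U then some (g (U.equivFin ⟨j, h⟩)) else none
  have h1 : labelled ψ = U := by
    ext j
    by_cases h : j ∈ U <;> simp [mem_labelled, ψ, h]
  refine ⟨ψ, h1, ?_⟩
  have h2 : labelContent ψ = ∑ j ∈ U, (ψ j).elim 0 fun i => Finsupp.single i 1 := by
    symm
    refine Finset.sum_subset (Finset.subset_univ _) fun j _ hj => ?_
    simp [ψ, hj]
  rw [h2, ← hg, content, ← Equiv.sum_comp U.equivFin, ← Finset.sum_coe_sort]
  refine Finset.sum_congr rfl fun j _ => ?_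
  simp [ψ]

/-- Group the labellings by their set `U` of labelled columns. Since `|U| = |δ|`, those with
labelled set `U` are the ones that leave `Uᶜ` free. -/
theorem polarizedEsymm_eq_sum_compl (δ : Fin ℓ →₀ ℕ) (S : Finset (Fin n)) :
    polarizedEsymm K δ S
      = ∑ U ∈ (Finset.powersetCard δ.degree Finset.univ).filter (Disjoint S),
          polarizedEsymm K δ Uᶜ := by
  classical
  rw [polarizedEsymm, ← Finset.sum_fiberwise_of_maps_to (g := labelled)
    (t := (Finset.powersetCard δ.degree Finset.univ).filter (Disjoint S))]
  · refine Finset.sum_congr rfl fun U hU => ?_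
    rw [polarizedEsymm]
    refine Finset.sum_congr ?_ fun _ _ => rfl
    obtain ⟨hU, hd⟩ := Finset.mem_filter.1 hU
    ext φ
    rw [Finset.mem_filter, mem_labellings, mem_labellings]
    constructor
    · rintro ⟨⟨-, h2⟩, rfl⟩
      refine ⟨fun j hj => ?_, h2⟩
      by_contra hc
      exact Finset.mem_compl.1 hj (mem_labelled.2 hc)
    · rintro ⟨h1, h2⟩
      have hsub : labelled φ ⊆ U := fun j hj => by
        by_contra hc
        exact mem_labelled.1 hj (h1 j (Finset.mem_compl.2 hc))
      have heq : labelled φ = U := Finset.eq_of_subset_of_card_le hsub (by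
        rw [(Finset.mem_powersetCard.1 hU).2, ← degree_labelContent, h2])
      refine ⟨⟨fun j hj => ?_, h2⟩, heq⟩
      by_contra hc
      exact Finset.disjoint_left.1 hd hj (heq ▸ mem_labelled.2 hc)
  · intro φ hφ
    obtain ⟨h1, h2⟩ := mem_labellings.1 hφ
    rw [Finset.mem_filter, Finset.mem_powersetCard, ← degree_labelContent, h2]
    exact ⟨⟨Finset.subset_univ _, rfl⟩, Finset.disjoint_left.2 fun j hj hj' =>
      mem_labelled.1 hj' (h1 j hj)⟩

/-- The expansion over complements gives one inclusion, and the full rank of the disjointness matrix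
gives the other. -/
theorem span_polarizedEsymm_eq_span_compl [CharZero K] (δ : Fin ℓ →₀ ℕ) {m : ℕ}
    (hm : δ.degree ≤ m) (hn : δ.degree + m ≤ n) :
    Submodule.span K (polarizedEsymm K δ '' {S : Finset (Fin n) | S.card = m})
      = Submodule.span K ((fun U : Finset (Fin n) => polarizedEsymm K δ Uᶜ)
          '' {U | U.card = δ.degree}) := by
  apply le_antisymm
  · refine Submodule.span_le.2 ?_
    rintro _ ⟨S, -, rfl⟩
    rw [SetLike.mem_coe, polarizedEsymm_eq_sum_compl]
    refine Submodule.sum_mem _ fun U hU => Submodule.subset_span ⟨U, ?_, rfl⟩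
    exact (Finset.mem_powersetCard.1 (Finset.mem_filter.1 hU).1).2
  · refine Submodule.span_le.2 ?_
    rintro _ ⟨U, hU, rfl⟩
    by_contra hcon
    -- A functional that vanishes on the smaller span but not on this vector would take values
    -- solving the homogeneous disjointness system.
    obtain ⟨g, hg, hle⟩ := Submodule.exists_le_ker_of_notMem hcon
    refine hg (eq_zero_of_sum_disjoint_eq_zero (f := fun U => g (polarizedEsymm K δ Uᶜ)) hm hn
      (fun S hS => ?_) U hU)
    rw [← map_sum, ← polarizedEsymm_eq_sum_compl]
    exact hle (Submodule.subset_span ⟨S, hS, rfl⟩)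

/-- Taking the coefficient at one labelling for each labelled set `U` turns a linear relation into
the homogeneous disjointness system. -/
theorem linearIndependent_polarizedEsymm [CharZero K] (δ : Fin ℓ →₀ ℕ) {m : ℕ}
    (hm : m ≤ δ.degree) (hn : m + δ.degree ≤ n) :
    LinearIndependent K fun S : {S : Finset (Fin n) // S.card = m} => polarizedEsymm K δ S.1 := by
  classical
  rw [Fintype.linearIndependent_iff]
  intro c hc S
  let f : Finset (Fin n) → K := fun S => if h : S.card = m then c ⟨S, h⟩ else 0
  have := eq_zero_of_sum_disjoint_eq_zero (f := f) hm hn (fun U hU => ?_) S.1 S.2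
  · simpa [f, S.2] using this
  · obtain ⟨ψ, hψ, hψδ⟩ := exists_labelling δ U hU
    have h1 := congrArg (coeff (cellExponent ψ)) hc
    rw [coeff_sum, coeff_zero] at h1
    simp only [coeff_smul, coeff_polarizedEsymm δ _ hψδ, hψ] at h1
    rw [Finset.sum_filter, Finset.sum_subtype (Finset.powersetCard m Finset.univ)
      (p := fun S => S.card = m) (by simp [Finset.mem_powersetCard])]
    refine Eq.trans (Finset.sum_congr rfl fun S _ => ?_) h1
    simp [f, S.2]

/-- A labelling of `U` has a nonzero coefficient only in the vector belonging to `U`. -/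
theorem linearIndependent_polarizedEsymm_compl (δ : Fin ℓ →₀ ℕ) :
    LinearIndependent K fun U : {U : Finset (Fin n) // U.card = δ.degree} =>
      polarizedEsymm K δ U.1ᶜ := by
  classical
  rw [Fintype.linearIndependent_iff]
  intro c hc U
  obtain ⟨ψ, hψ, hψδ⟩ := exists_labelling δ U.1 U.2
  have h1 := congrArg (coeff (cellExponent ψ)) hc
  rw [coeff_sum, coeff_zero, Finset.sum_eq_single U] at h1
  · rw [coeff_smul, coeff_polarizedEsymm δ _ hψδ, hψ, if_pos disjoint_compl_right] at h1
    simpa using h1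
  · intro U' _ hne
    rw [coeff_smul, coeff_polarizedEsymm δ _ hψδ, hψ, if_neg, smul_zero]
    rw [Finset.disjoint_left]
    intro h
    have hsub : U.1 ⊆ U'.1 := fun j hj => by
      have := h hj
      rwa [Finset.mem_compl, not_not] at this
    exact hne (Subtype.ext (Finset.eq_of_subset_of_card_le hsub (U'.2.trans U.2.symm).le).symm)
  · simp

/-- The full-rank condition reads `|δ| + (d - |δ|) = d ≤ n` in both ranges. The smaller of `|δ|` and
`d - |δ|` is the size of the subsets indexing the basis. -/
theorem coeff_frobeniusChar_esymm [CharZero K] (i₀ : Fin ℓ) {d : ℕ} (hd : d ≤ n)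
    (δ : Fin ℓ →₀ ℕ) :
    MvPowerSeries.coeff δ (frobeniusChar (polarizationModuleOf (inRow i₀ (esymm (Fin n) K d))))
      = if δ.degree ≤ d / 2 then
          completeHomog ℕ K (n - δ.degree) * completeHomog ℕ K δ.degree
        else if δ.degree ≤ d then
          completeHomog ℕ K (n - d + δ.degree) * completeHomog ℕ K (d - δ.degree)
        else 0 := by
  have hcomp := component_toSubmodule_of_span _
    (fun x : {x : (Fin ℓ →₀ ℕ) × Finset (Fin n) // x.2.card + x.1.degree = d} => x.1.1)
    (fun x => isWeightedHomogeneous_polarizedEsymm x.1.1 x.1.2) _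
    (polarizationModuleOf_esymm (K := K) (n := n) i₀ d) δ
  have himage : δ.degree ≤ d →
      (fun x : {x : (Fin ℓ →₀ ℕ) × Finset (Fin n) // x.2.card + x.1.degree = d} =>
        polarizedEsymm K x.1.1 x.1.2) '' {x | x.1.1 = δ}
        = polarizedEsymm K δ '' {S : Finset (Fin n) | S.card = d - δ.degree} := by
    intro h
    ext f
    constructor
    · rintro ⟨⟨⟨δ', S⟩, hx⟩, h', rfl⟩
      obtain rfl : δ' = δ := h'
      exact ⟨S, Nat.eq_sub_of_add_eq hx, rfl⟩
    · rintro ⟨S, hS, rfl⟩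
      exact ⟨⟨(δ, S), (congrArg (· + δ.degree) hS).trans (Nat.sub_add_cancel h)⟩, rfl, rfl⟩
  split_ifs with h1 h2
  · rw [himage (by omega), span_polarizedEsymm_eq_span_compl δ (by omega) (by omega)] at hcomp
    refine coeff_frobeniusChar_of_basis (by omega) _ δ (fun U => polarizedEsymm K δ Uᶜ)
      (linearIndependent_polarizedEsymm_compl δ) hcomp fun σ U _ => ?_
    rw [diagRep_polarizedEsymm]
    congr 1
    ext j
    simp [Finset.mem_map_equiv]
  · rw [himage h2] at hcomp
    rw [coeff_frobeniusChar_of_basis (b := d - δ.degree) (by omega) _ δ (polarizedEsymm K δ)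
      (linearIndependent_polarizedEsymm δ (by omega) (by omega)) hcomp
      fun σ S _ => diagRep_polarizedEsymm σ δ S, show n - (d - δ.degree) = n - d + δ.degree by omega]
  · refine coeff_frobeniusChar_of_bot _ _ ?_
    rw [hcomp, show {x : {x : (Fin ℓ →₀ ℕ) × Finset (Fin n) // x.2.card + x.1.degree = d} |
      x.1.1 = δ} = ∅ from ?_, Set.image_empty, Submodule.span_empty]
    rw [Set.eq_empty_iff_forall_notMem]
    rintro ⟨⟨δ', S⟩, hx⟩ h'
    obtain rfl : δ' = δ := h'
    dsimp only at hx
    omega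

end Elementary

/-! ### Assembling the coefficients, and passage to Schur functions -/

section Assembly

variable {K : Type*} [Field K] {ℓ n : ℕ}

theorem coeff_hQ_mul_C (k : ℕ) (a : SeriesW K) (δ : Fin ℓ →₀ ℕ) :
    MvPowerSeries.coeff δ (hQ K ℓ k * MvPowerSeries.C a) = if δ.degree = k then a else 0 := by
  rw [MvPowerSeries.coeff_mul_C]
  change (if δ.degree = k then (1 : SeriesW K) else 0) * a = _
  split_ifs <;> simp

theorem frobeniusChar_psum_one_pow [CharZero K] (i₀ : Fin ℓ) (hn : 1 ≤ n) (d : ℕ) :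
    frobeniusChar (polarizationModuleOf (inRow i₀ (MvPolynomial.psum (Fin n) K 1 ^ d)))
      = (∑ j ∈ Finset.range (d + 1), hQ K ℓ j) * hW K ℓ n := by
  ext1 δ
  rw [coeff_frobeniusChar_psum_one_pow i₀ hn, Finset.sum_mul, map_sum]
  simp only [hW, coeff_hQ_mul_C, Finset.sum_ite_eq, Finset.mem_range, Nat.lt_succ_iff]

theorem frobeniusChar_psum [CharZero K] (i₀ : Fin ℓ) (hn : 1 ≤ n) {d : ℕ} (hd : 1 ≤ d) :
    frobeniusChar (polarizationModuleOf (inRow i₀ (MvPolynomial.psum (Fin n) K d)))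
      = (1 + hQ K ℓ d) * hW K ℓ n
        + (∑ j ∈ Finset.Icc 1 (d - 1), hQ K ℓ j) * (hW K ℓ (n - 1) * hW K ℓ 1) := by
  ext1 δ
  rw [coeff_frobeniusChar_psum i₀ hn hd, show (1 : SeriesQW K ℓ) = hQ K ℓ 0 from
    (completeHomog_zero _ _).symm, add_mul, Finset.sum_mul, map_add, map_add, map_sum]
  simp only [hW, ← map_mul, coeff_hQ_mul_C, Finset.sum_ite_eq, Finset.mem_Icc]
  by_cases h0 : δ.degree = 0
  · rw [if_pos (Or.inl h0), if_pos h0, if_neg (by omega), if_neg (by omega), add_zero, add_zero]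
  · by_cases h1 : δ.degree = d
    · rw [if_pos (Or.inr h1), if_neg h0, if_pos h1, if_neg (by omega), add_zero, zero_add]
    · rw [if_neg (by omega), if_neg h0, if_neg h1, zero_add, zero_add]
      exact if_congr (by omega) rfl rfl

theorem frobeniusChar_esymm [CharZero K] (i₀ : Fin ℓ) {d : ℕ} (hd : d ≤ n) :
    frobeniusChar (polarizationModuleOf (inRow i₀ (MvPolynomial.esymm (Fin n) K d)))
      = ∑ i ∈ Finset.range (d / 2 + 1), hW K ℓ (n - i) * hW K ℓ i * hQ K ℓ i
        + ∑ i ∈ Finset.Icc (d / 2 + 1) d, hW K ℓ (n - d + i) * hW K ℓ (d - i) * hQ K ℓ i := by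
  ext1 δ
  rw [coeff_frobeniusChar_esymm i₀ hd, map_add, map_sum, map_sum]
  simp only [mul_comm _ (hQ K ℓ _), hW, ← map_mul, coeff_hQ_mul_C, Finset.sum_ite_eq,
    Finset.mem_range, Finset.mem_Icc]
  by_cases h0 : δ.degree ≤ d / 2
  · rw [if_pos h0, if_pos (by omega), if_neg (by omega), add_zero]
  · rw [if_neg h0, if_neg (c := δ.degree < d / 2 + 1) (by omega), zero_add]
    exact if_congr (by omega) rfl rfl

/-- The two-row Jacobi–Trudi identity telescopes; `2 * b ≤ n` keeps every shape weakly decreasing.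
-/
theorem hW_mul_hW_eq_sum {b : ℕ} (hb : 2 * b ≤ n) :
    hW K ℓ (n - b) * hW K ℓ b = ∑ i ∈ Finset.range (b + 1), sW K ℓ [n - i, i] := by
  induction b with
  | zero => simp [sW_pair_zero, hW_zero]
  | succ b ih =>
    rw [Finset.sum_range_succ, ← ih (by omega), ← sW_pair_add K ℓ (b := b + 1) (by omega) (by omega),
      show n - (b + 1) + 1 = n - b by omega, Nat.add_sub_cancel, add_comm]

/-- Exchange the sums: for fixed `j` the index `i` runs up to `min j (d - j)`, and the Schur
functions add up to a product of two complete homogeneous functions. -/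
theorem sum_Icc_mul_sW_eq {d : ℕ} (hd : d ≤ n) :
    ∑ i ∈ Finset.range (d / 2 + 1), (∑ j ∈ Finset.Icc i (d - i), hQ K ℓ j) * sW K ℓ [n - i, i]
      = ∑ i ∈ Finset.range (d / 2 + 1), hW K ℓ (n - i) * hW K ℓ i * hQ K ℓ i
        + ∑ i ∈ Finset.Icc (d / 2 + 1) d, hW K ℓ (n - d + i) * hW K ℓ (d - i) * hQ K ℓ i := by
  simp only [Finset.sum_mul]
  rw [Finset.sum_comm' (t' := Finset.range (d + 1))
    (s' := fun j => Finset.range (min j (d - j) + 1))]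
  · have hsplit : Finset.range (d + 1) = Finset.range (d / 2 + 1) ∪ Finset.Icc (d / 2 + 1) d := by
      ext i
      simp only [Finset.mem_range, Finset.mem_union, Finset.mem_Icc]
      omega
    rw [hsplit, Finset.sum_union]
    · congr 1
      · refine Finset.sum_congr rfl fun j hj => ?_
        have hj := Finset.mem_range.1 hj
        rw [hW_mul_hW_eq_sum (by omega), ← Finset.mul_sum, mul_comm, min_eq_left (by omega)]
      · refine Finset.sum_congr rfl fun j hj => ?_
        have hj := Finset.mem_Icc.1 hj
        rw [show n - d + j = n - (d - j) by omega, hW_mul_hW_eq_sum (by omega), ← Finset.mul_sum,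
          mul_comm, min_eq_right (by omega)]
    · rw [Finset.disjoint_left]
      intro i h1 h2
      have h1 := Finset.mem_range.1 h1
      have h2 := Finset.mem_Icc.1 h2
      omega
  · intro i j
    simp only [Finset.mem_range, Finset.mem_Icc]
    omega

theorem sum_range_mul_add_sum_Icc_mul {d : ℕ} (hn : 1 ≤ n) (hd : 1 ≤ d) :
    (∑ j ∈ Finset.range (d + 1), hQ K ℓ j) * hW K ℓ n
        + (∑ j ∈ Finset.Icc 1 (d - 1), hQ K ℓ j) * sW K ℓ [n - 1, 1]
      = (1 + hQ K ℓ d) * hW K ℓ n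
        + (∑ j ∈ Finset.Icc 1 (d - 1), hQ K ℓ j) * (hW K ℓ (n - 1) * hW K ℓ 1) := by
  have hsplit : ∑ j ∈ Finset.range (d + 1), hQ K ℓ j
      = (1 + hQ K ℓ d) + ∑ j ∈ Finset.Icc 1 (d - 1), hQ K ℓ j := by
    obtain ⟨m, rfl⟩ := Nat.exists_eq_add_of_le' hd
    rw [Finset.sum_range_succ, Finset.sum_range_eq_add_Ico _ (Nat.succ_pos m),
      show hQ K ℓ 0 = 1 from completeHomog_zero _ _]
    change 1 + ∑ j ∈ Finset.Icc 1 m, hQ K ℓ j + _ = _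
    rw [Nat.add_sub_cancel]
    ring
  have hs : hW K ℓ (n - 1) * hW K ℓ 1 = hW K ℓ n + sW K ℓ [n - 1, 1] := by
    -- For `n = 1` the list `[0, 1]` is not weakly decreasing and `schur` returns `0`, matching the
    -- convention `s_{0,1} = 0`.
    rcases hn.eq_or_lt with rfl | h
    · have hnot : ¬ [1 - 1, 1].SortedGE := by
        simp [List.sortedGE_iff_pairwise]
      rw [sW, schur, dif_neg hnot, map_zero, add_zero, Nat.sub_self, hW_zero, one_mul]
    · rw [← sW_pair_add K ℓ le_rfl (by omega), Nat.sub_add_cancel hn, Nat.sub_self, hW_zero, mul_one,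
        add_comm]
  rw [hsplit, hs]
  ring

end Assembly

end

end Polarization

open Polarization in
theorem theorem1 {K : Type*} [Field K] [CharZero K] (ℓ n d : ℕ) (hℓ : 1 ≤ ℓ) (hn : 1 ≤ n)
    (hd : 1 ≤ d) :
    (frobeniusChar (polarizationModuleOf
          (inRow (⟨0, hℓ⟩ : Fin ℓ) (MvPolynomial.psum (Fin n) K 1 ^ d)))
        = (∑ j ∈ Finset.range (d + 1), sQ K ℓ j) * sW K ℓ [n] ∧
      frobeniusChar (polarizationModuleOf
          (inRow (⟨0, hℓ⟩ : Fin ℓ) (MvPolynomial.psum (Fin n) K 1 ^ d)))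
        = (∑ j ∈ Finset.range (d + 1), hQ K ℓ j) * hW K ℓ n) ∧
    (frobeniusChar (polarizationModuleOf
          (inRow (⟨0, hℓ⟩ : Fin ℓ) (MvPolynomial.psum (Fin n) K d)))
        = (∑ j ∈ Finset.range (d + 1), sQ K ℓ j) * sW K ℓ [n]
          + (∑ j ∈ Finset.Icc 1 (d - 1), sQ K ℓ j) * sW K ℓ [n - 1, 1] ∧
      frobeniusChar (polarizationModuleOf
          (inRow (⟨0, hℓ⟩ : Fin ℓ) (MvPolynomial.psum (Fin n) K d)))
        = (1 + hQ K ℓ d) * hW K ℓ n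
          + (∑ j ∈ Finset.Icc 1 (d - 1), hQ K ℓ j) * (hW K ℓ (n - 1) * hW K ℓ 1)) ∧
    (d ≤ n →
      frobeniusChar (polarizationModuleOf
          (inRow (⟨0, hℓ⟩ : Fin ℓ) (MvPolynomial.esymm (Fin n) K d)))
        = ∑ i ∈ Finset.range (d / 2 + 1),
            (∑ j ∈ Finset.Icc i (d - i), sQ K ℓ j) * sW K ℓ [n - i, i] ∧
      frobeniusChar (polarizationModuleOf
          (inRow (⟨0, hℓ⟩ : Fin ℓ) (MvPolynomial.esymm (Fin n) K d)))
        = ∑ i ∈ Finset.range (d / 2 + 1), hW K ℓ (n - i) * hW K ℓ i * hQ K ℓ i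
          + ∑ i ∈ Finset.Icc (d / 2 + 1) d,
              hW K ℓ (n - d + i) * hW K ℓ (d - i) * hQ K ℓ i) := by
  have hsum : ∀ s : Finset ℕ, ∑ j ∈ s, sQ K ℓ j = ∑ j ∈ s, hQ K ℓ j := fun s =>
    Finset.sum_congr rfl fun j _ => sQ_eq_hQ K ℓ j
  simp only [hsum, sW_singleton]
  refine ⟨⟨frobeniusChar_psum_one_pow _ hn d, frobeniusChar_psum_one_pow _ hn d⟩, ⟨?_, ?_⟩,
    fun hdn => ⟨?_, frobeniusChar_esymm _ hdn⟩⟩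
  · rw [sum_range_mul_add_sum_Icc_mul hn hd, frobeniusChar_psum _ hn hd]
  · exact frobeniusChar_psum _ hn hd
  · rw [sum_Icc_mul_sW_eq hdn, frobeniusChar_esymm _ hdn]
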